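/- Let $\mathbb G$ be a homogeneous group: a Lie group structure $\circ$ on $\mathbb R^N$, $N\ge 1$, with identity $0$, together with $v_1,\dots,v_N>0$ such that for every $\lambda>0$ the dilation $D_\lambda(x)=(\lambda^{v_1}x_1,\dots,\lambda^{v_N}x_N)$ is a group automorphism. Let $Q=v_1+\dots+v_N$ be its homogeneous dimension and $dx$ Lebesgue (Haar) measure. Let $|\cdot|$ be a quasi-norm on $\mathbb G$, i.e. a continuous function $\mathbb G\to[0,\infty)$ with $|x^{-1}|=|x|$, $|D_\lambda x|=\lambda|x|$ for $\lambda>0$, and $|x|=0\iff x=0$. Write $\mathbb B(0,R)=\{y:|y|<R\}$, $\mathfrak S=\{x:|x|=1\}$, and let $|\mathfrak S|=\sigma(\mathfrak S)$, where $\sigma$ is the Radon measure on $\mathfrak S$ with $\int_{\mathbb G}f\,dx=\int_0^\infty\int_{\mathfrak S}f(D_ry)\,r^{Q-1}\,d\sigma(y)\,dr$. Let $1<p\le q<\infty$, $p'=p/(p-1)$, and $\alpha,\beta\in\mathbb R$. There is a finite constant $C\ge 0$ such that $$\left(\int_{\mathbb G}\left|\int_{\mathbb B(0,|x|)}u(y)\,dy\right|^q|x|^\beta\,dx\right)^{1/q}\le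 C\left(\int_{\mathbb G}|u(x)|^p|x|^\alpha\,dx\right)^{1/p}\qquad(*)$$ holds for all measurable (real- or complex-valued) functions $u$ on $\mathbb G$ if and only if $$\alpha<Q(p-1)\quad\text{and}\quad q(\alpha+Q)-p(\beta+Q)=pqQ.\qquad(**)$$ If $(**)$ holds, then every measurable $u$ with finite right-hand side in $(*)$ is integrable on every ball $\mathbb B(0,R)$, and the sharp (that is, least) constant $C=C(p,q,Q,\alpha)$ for which $(*)$ holds for all measurable $u$ is, when $p<q$, $$C(p,q,Q,\alpha)=|\mathfrak S|^{1+\frac1q-\frac1p}\left(\frac{p-1}{Q(p-1)-\alpha}\right)^{\frac1{p'}+\frac1q}\left(\frac{p'}{q}\right)^{\frac1q}\left(\frac{\frac{q-p}{p}\,\Gamma\!\left(\frac{pq}{q-p}\right)}{\Gamma\!\left(\frac{p}{q-p}\right)\Gamma\!\left(\frac{p(q-1)}{q-p}\right)}\right)^{\frac1p-\frac1q},$$ and, when $p=q$, $$C(p,p,Q,\alpha)=\frac{p\,|\mathfrak S|}{Q(p-1)-\alpha}=\lim_{s\to q^-}C(s,q,Q,\alpha),$$ where $C(s,q,Q,\alpha)$,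 $s<q$, is given by the first formula with $p$ replaced by $s$. -/

import Mathlib

open MeasureTheory Set Filter Topology
open scoped ENNReal

/-- A homogeneous group: a Lie group structure on `ℝ^N` (with the coordinate origin as identity)
together with positive weights `v₁, …, v_N` such that the dilations
`D_r x = (r ^ v₁ x₁, …, r ^ v_N x_N)`, `r > 0`, are group automorphisms. -/
structure HomogeneousGroup (N : ℕ) where
  mul : (Fin N → ℝ) → (Fin N → ℝ) → (Fin N → ℝ)
  inv : (Fin N → ℝ) → (Fin N → ℝ)
  mul_assoc : ∀ x y z, mul (mul x y) z = mul x (mul y z)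
  zero_mul : ∀ x, mul 0 x = x
  mul_zero : ∀ x, mul x 0 = x
  inv_mul : ∀ x, mul (inv x) x = 0
  contDiff_mul : ContDiff ℝ (⊤ : ℕ∞) fun z : (Fin N → ℝ) × (Fin N → ℝ) => mul z.1 z.2
  contDiff_inv : ContDiff ℝ (⊤ : ℕ∞) inv
  weight : Fin N → ℝ
  weight_pos : ∀ i, 0 < weight i
  dil_mul : ∀ r : ℝ, 0 < r → ∀ x y : Fin N → ℝ,
    (fun i => r ^ weight i * mul x y i) =
      mul (fun i => r ^ weight i * x i) (fun i => r ^ weight i * y i)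

namespace HomogeneousGroup

variable {N : ℕ}

/-- The dilation `D_r`. -/
noncomputable def dil (G : HomogeneousGroup N) (r : ℝ) (x : Fin N → ℝ) : Fin N → ℝ :=
  fun i => r ^ G.weight i * x i

/-- The homogeneous dimension `Q = v₁ + … + v_N`. -/
noncomputable def homDim (G : HomogeneousGroup N) : ℝ := ∑ i, G.weight i

/-- A (homogeneous) quasi-norm on a homogeneous group. -/
structure QuasiNorm (G : HomogeneousGroup N) where
  toFun : (Fin N → ℝ) → ℝ
  continuous_toFun : Continuous toFun
  nonneg : ∀ x, 0 ≤ toFun x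
  inv_eq : ∀ x, toFun (G.inv x) = toFun x
  dil_eq : ∀ r : ℝ, 0 < r → ∀ x, toFun (G.dil r x) = r * toFun x
  eq_zero_iff : ∀ x, toFun x = 0 ↔ x = 0

namespace QuasiNorm

variable {G : HomogeneousGroup N}

/-- The quasi-ball `𝔹(x, R) = {y : |x⁻¹ ∘ y| < R}`. -/
def ball (ρ : QuasiNorm G) (x : Fin N → ℝ) (R : ℝ) : Set (Fin N → ℝ) :=
  {y | ρ.toFun (G.mul (G.inv x) y) < R}

/-- The unit sphere `𝔖 = {x : |x| = 1}`. -/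
def sphere (ρ : QuasiNorm G) : Set (Fin N → ℝ) := {x | ρ.toFun x = 1}

/-- The radial projection `x ↦ D_{1/|x|} x` of `G \ {0}` onto the unit sphere. -/
noncomputable def proj (ρ : QuasiNorm G) (x : Fin N → ℝ) : Fin N → ℝ := G.dil (ρ.toFun x)⁻¹ x

/-- The surface measure `σ` on the unit sphere, as a measure on the ambient space concentrated on
the sphere: `σ(A) = Q · vol {x : 0 < |x| < 1, D_{1/|x|} x ∈ A}`. It is the measure of the polar
decomposition `∫ f dx = ∫₀^∞ ∫_𝔖 f(D_r y) r^{Q-1} dσ(y) dr`, see `lintegral_polar` below. -/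
noncomputable def surfaceMeasure (ρ : QuasiNorm G) : Measure (Fin N → ℝ) :=
  ENNReal.ofReal G.homDim • (volume.restrict (ρ.ball 0 1 \ {0})).map ρ.proj

/-- The measure `|𝔖|` of the unit sphere. -/
noncomputable def sphereArea (ρ : QuasiNorm G) : ℝ := (ρ.surfaceMeasure ρ.sphere).toReal

end QuasiNorm

/-! Helper facts: finiteness of the surface measure and the polar decomposition. -/

theorem dil_dil (G : HomogeneousGroup N) {r s : ℝ} (hr : 0 ≤ r) (hs : 0 ≤ s) (x : Fin N → ℝ) :
    G.dil r (G.dil s x) = G.dil (r * s) x := by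
  funext i
  simp only [dil, Real.mul_rpow hr hs]
  ring

theorem dil_one (G : HomogeneousGroup N) (x : Fin N → ℝ) : G.dil 1 x = x := by
  funext i
  simp [dil]

theorem dil_zero (G : HomogeneousGroup N) (r : ℝ) : G.dil r 0 = 0 := by
  funext i
  simp [dil]

theorem measurable_dil (G : HomogeneousGroup N) :
    Measurable fun z : ℝ × (Fin N → ℝ) => G.dil z.1 z.2 := by
  unfold dil
  fun_prop

theorem inv_zero (G : HomogeneousGroup N) : G.inv 0 = 0 := by
  have h := G.inv_mul 0
  rwa [G.mul_zero] at h

theorem homDim_pos (G : HomogeneousGroup N) (hN : 0 < N) : 0 < G.homDim := by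
  have : Nonempty (Fin N) := ⟨⟨0, hN⟩⟩
  exact Finset.sum_pos (fun i _ => G.weight_pos i) Finset.univ_nonempty

theorem volume_dil_preimage (G : HomogeneousGroup N) {r : ℝ} (hr : 0 < r)
    {s : Set (Fin N → ℝ)} (hs : MeasurableSet s) :
    volume s = ENNReal.ofReal (r ^ G.homDim) * volume (G.dil r ⁻¹' s) := by
  have hdet : (Matrix.diagonal fun i => r ^ G.weight i).det = r ^ G.homDim := by
    rw [Matrix.det_diagonal, homDim, Real.rpow_sum_of_pos hr]
  have hpos : 0 < r ^ G.homDim := Real.rpow_pos_of_pos hr _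
  have hlin : (⇑(Matrix.toLin' (Matrix.diagonal fun i => r ^ G.weight i)) :
      (Fin N → ℝ) → Fin N → ℝ) = G.dil r := by
    funext x i
    simp [dil, Matrix.mulVec_diagonal]
  have h := Real.smul_map_diagonal_volume_pi (D := fun i => r ^ G.weight i)
    (by rw [hdet]; exact hpos.ne')
  rw [hdet, abs_of_pos hpos, hlin] at h
  have hm : Measurable (G.dil r) := by unfold dil; fun_prop
  conv_lhs => rw [← h]
  rw [Measure.smul_apply, Measure.map_apply hm hs, smul_eq_mul]

namespace QuasiNorm

variable {G : HomogeneousGroup N}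

theorem mem_ball_zero (ρ : QuasiNorm G) {x : Fin N → ℝ} {R : ℝ} :
    x ∈ ρ.ball 0 R ↔ ρ.toFun x < R := by
  simp [ball, G.inv_zero, G.zero_mul]

theorem toFun_pos (ρ : QuasiNorm G) {x : Fin N → ℝ} (hx : x ≠ 0) : 0 < ρ.toFun x :=
  lt_of_le_of_ne (ρ.nonneg x) fun h => hx ((ρ.eq_zero_iff x).1 h.symm)

theorem proj_mem_sphere (ρ : QuasiNorm G) {x : Fin N → ℝ} (hx : x ≠ 0) :
    ρ.proj x ∈ ρ.sphere := by
  have h := ρ.toFun_pos hx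
  simp only [sphere, proj, mem_ofPred_eq]
  rw [ρ.dil_eq _ (inv_pos.2 h), inv_mul_cancel₀ h.ne']

theorem dil_proj (ρ : QuasiNorm G) {x : Fin N → ℝ} (hx : x ≠ 0) :
    G.dil (ρ.toFun x) (ρ.proj x) = x := by
  have h := ρ.toFun_pos hx
  rw [proj, G.dil_dil h.le (inv_pos.2 h).le, mul_inv_cancel₀ h.ne', G.dil_one]

theorem proj_dil (ρ : QuasiNorm G) {r : ℝ} (hr : 0 < r) (x : Fin N → ℝ) :
    ρ.proj (G.dil r x) = ρ.proj x := by
  have h := ρ.nonneg x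
  rw [proj, ρ.dil_eq r hr, G.dil_dil (by positivity) hr.le, proj, mul_inv, mul_comm r⁻¹,
    _root_.mul_assoc, inv_mul_cancel₀ hr.ne', mul_one]

theorem measurable_toFun (ρ : QuasiNorm G) : Measurable ρ.toFun := ρ.continuous_toFun.measurable

theorem measurable_proj (ρ : QuasiNorm G) : Measurable ρ.proj :=
  G.measurable_dil.comp (ρ.measurable_toFun.inv.prodMk measurable_id)

theorem measurableSet_ball_zero (ρ : QuasiNorm G) (R : ℝ) : MeasurableSet (ρ.ball 0 R) := by
  have : ρ.ball 0 R = ρ.toFun ⁻¹' Iio R := by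
    ext x
    exact ρ.mem_ball_zero
  rw [this]
  exact ρ.measurable_toFun measurableSet_Iio

theorem volume_ball_lt_top (ρ : QuasiNorm G) : volume (ρ.ball 0 1) < ∞ := by
  obtain ⟨m, hm, hsub⟩ : ∃ m > 0, ρ.ball 0 m ⊆ Metric.ball (0 : Fin N → ℝ) 1 := by
    rcases (Metric.sphere (0 : Fin N → ℝ) 1).eq_empty_or_nonempty with he | hne
    · refine ⟨1, one_pos, fun x _ => ?_⟩
      by_contra hx
      have hx0 : x ≠ 0 := by
        rintro rfl
        simp at hx
      have : ‖x‖⁻¹ • x ∈ Metric.sphere (0 : Fin N → ℝ) 1 := by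
        simp [norm_smul, hx0]
      rw [he] at this
      exact this
    · obtain ⟨z, hz, hmin⟩ := (isCompact_sphere (0 : Fin N → ℝ) 1).exists_isMinOn hne
        ρ.continuous_toFun.continuousOn
      have hz0 : z ≠ 0 := by
        rintro rfl
        simp at hz
      refine ⟨ρ.toFun z, ρ.toFun_pos hz0, fun x hx => ?_⟩
      by_contra hx1
      have hx1' : 1 ≤ ‖x‖ := by simpa using hx1
      have hcont : ContinuousOn (fun r : ℝ => ‖G.dil r x‖) (Icc 0 1) := by
        refine Continuous.continuousOn (Continuous.norm ?_)
        refine continuous_pi fun i => ?_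
        exact (Real.continuous_rpow_const (G.weight_pos i).le).mul continuous_const
      have h0 : ‖G.dil 0 x‖ = 0 := by
        have : G.dil 0 x = 0 := by
          funext i
          simp [dil, Real.zero_rpow (G.weight_pos i).ne']
        rw [this, norm_zero]
      obtain ⟨r, hr, hr1⟩ := intermediate_value_Icc zero_le_one hcont
        (show (1 : ℝ) ∈ Icc (‖G.dil 0 x‖) (‖G.dil 1 x‖) by
          rw [h0, G.dil_one]; exact ⟨zero_le_one, hx1'⟩)
      have hr0 : 0 < r := by
        rcases hr.1.lt_or_eq with h | h
        · exact h
        · subst h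
          simp only [h0] at hr1
          exact absurd hr1 zero_ne_one
      have hle : ρ.toFun z ≤ ρ.toFun (G.dil r x) := hmin (by simpa using hr1)
      rw [ρ.dil_eq r hr0] at hle
      have hx' := ρ.mem_ball_zero.1 hx
      nlinarith [ρ.nonneg x, hr.2]
  have hpre : G.dil m⁻¹ ⁻¹' ρ.ball 0 1 = ρ.ball 0 m := by
    ext x
    rw [mem_preimage, ρ.mem_ball_zero, ρ.mem_ball_zero, ρ.dil_eq _ (inv_pos.2 hm),
      inv_mul_lt_iff₀ hm, mul_one]
  rw [G.volume_dil_preimage (inv_pos.2 hm) (ρ.measurableSet_ball_zero 1), hpre]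
  exact ENNReal.mul_lt_top ENNReal.ofReal_lt_top
    ((measure_mono hsub).trans_lt Metric.isBounded_ball.measure_lt_top)

theorem surfaceMeasure_apply (ρ : QuasiNorm G) {A : Set (Fin N → ℝ)} (hA : MeasurableSet A) :
    ρ.surfaceMeasure A =
      ENNReal.ofReal G.homDim * volume (ρ.proj ⁻¹' A ∩ (ρ.ball 0 1 \ {0})) := by
  rw [surfaceMeasure, Measure.smul_apply, Measure.map_apply ρ.measurable_proj hA,
    Measure.restrict_apply (ρ.measurable_proj hA), smul_eq_mul]

instance isFiniteMeasure_surfaceMeasure (ρ : QuasiNorm G) :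
    IsFiniteMeasure ρ.surfaceMeasure where
  measure_univ_lt_top := by
    rw [ρ.surfaceMeasure_apply MeasurableSet.univ]
    exact ENNReal.mul_lt_top ENNReal.ofReal_lt_top
      ((measure_mono (inter_subset_right.trans sdiff_subset)).trans_lt ρ.volume_ball_lt_top)

theorem measurableSet_sphere (ρ : QuasiNorm G) : MeasurableSet ρ.sphere :=
  ρ.measurable_toFun (measurableSet_singleton 1)

theorem surfaceMeasure_compl_sphere (ρ : QuasiNorm G) : ρ.surfaceMeasure ρ.sphereᶜ = 0 := by
  rw [ρ.surfaceMeasure_apply ρ.measurableSet_sphere.compl]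
  have : ρ.proj ⁻¹' ρ.sphereᶜ ∩ (ρ.ball 0 1 \ {0}) = ∅ := by
    ext x
    simp only [mem_inter_iff, mem_preimage, mem_compl_iff, Set.mem_sdiff, mem_singleton_iff,
      mem_empty_iff_false, iff_false]
    rintro ⟨h, -, hx⟩
    exact h (ρ.proj_mem_sphere hx)
  rw [this, measure_empty, MulZeroClass.mul_zero]

/-- Polar decomposition with respect to `surfaceMeasure`. -/
theorem lintegral_polar (ρ : QuasiNorm G) (hN : 0 < N) {f : (Fin N → ℝ) → ℝ≥0∞}
    (hf : Measurable f) :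
    ∫⁻ x, f x = ∫⁻ r in Ioi (0 : ℝ), (∫⁻ y in ρ.sphere, f (G.dil r y) ∂ρ.surfaceMeasure) *
      ENNReal.ofReal (r ^ (G.homDim - 1)) := by
  have : Nonempty (Fin N) := ⟨⟨0, hN⟩⟩
  have hQ := G.homDim_pos hN
  set w : ℝ → ℝ≥0∞ := fun r => ENNReal.ofReal (r ^ (G.homDim - 1)) with hw
  have hwm : Measurable w := by
    rw [hw]
    fun_prop
  set ν : Measure ℝ := (volume.restrict (Ioi (0 : ℝ))).withDensity w with hν
  set Φ : (Fin N → ℝ) → ℝ × (Fin N → ℝ) := fun x => (ρ.toFun x, ρ.proj x) with hΦ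
  have hΦm : Measurable Φ := ρ.measurable_toFun.prodMk ρ.measurable_proj
  have hνIio : ∀ a : ℝ, 0 < a → ν (Iio a) = ENNReal.ofReal (a ^ G.homDim / G.homDim) := by
    intro a ha
    rw [hν, withDensity_apply _ measurableSet_Iio, Measure.restrict_restrict measurableSet_Iio,
      inter_comm, Ioi_inter_Iio, Measure.restrict_congr_set Ioo_ae_eq_Ioc, hw,
      ← ofReal_integral_eq_lintegral_ofReal, ← intervalIntegral.integral_of_le ha.le,
      integral_rpow (Or.inl (by linarith))]
    · simp [Real.zero_rpow hQ.ne']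
    · exact (intervalIntegrable_iff_integrableOn_Ioc_of_le ha.le).1
        (intervalIntegral.intervalIntegrable_rpow' (by linarith))
    · filter_upwards [ae_restrict_mem measurableSet_Ioc] with r hr
      exact Real.rpow_nonneg hr.1.le _
  have hνIio' : ∀ a : ℝ, a ≤ 0 → ν (Iio a) = 0 := by
    intro a ha
    rw [hν, withDensity_apply _ measurableSet_Iio, Measure.restrict_restrict measurableSet_Iio,
      inter_comm, Ioi_inter_Iio, Ioo_eq_empty (by simpa using ha)]
    simp
  have hprod : ν.prod ρ.surfaceMeasure = (volume.restrict {0}ᶜ).map Φ := by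
    refine Measure.prod_eq_generateFrom
      ((borel_eq_generateFrom_Iio ℝ).symm.trans BorelSpace.measurable_eq.symm)
      MeasurableSpace.generateFrom_measurableSet isPiSystem_Iio MeasurableSpace.isPiSystem_measurableSet
      ⟨fun k : ℕ => Iio ((k : ℝ) + 1), fun k => mem_range_self _, fun k => ?_, ?_⟩
      ρ.surfaceMeasure.toFiniteSpanningSetsIn ?_
    · rw [hνIio _ (by positivity)]
      exact ENNReal.ofReal_lt_top
    · exact iUnion_eq_univ_iff.2 fun x => ⟨⌊x⌋₊, Nat.lt_floor_add_one x⟩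
    · rintro _ ⟨a, rfl⟩ A hA
      have hA' : MeasurableSet A := hA
      rw [Measure.map_apply hΦm (measurableSet_Iio.prod hA'),
        Measure.restrict_apply (hΦm (measurableSet_Iio.prod hA'))]
      rcases le_or_gt a 0 with ha | ha
      · rw [hνIio' a ha, MulZeroClass.zero_mul]
        have : Φ ⁻¹' Iio a ×ˢ A ∩ {0}ᶜ = ∅ := by
          ext x
          simp only [hΦ, mem_inter_iff, mem_preimage, mem_prod, mem_Iio, mem_empty_iff_false,
            iff_false]
          rintro ⟨⟨h, -⟩, -⟩
          exact absurd (ρ.nonneg x) (by linarith)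
        rw [this, measure_empty]
      · have hset : MeasurableSet (Φ ⁻¹' Iio a ×ˢ A ∩ {0}ᶜ) :=
          (hΦm (measurableSet_Iio.prod hA')).inter (measurableSet_singleton _).compl
        rw [G.volume_dil_preimage ha hset, hνIio a ha, ρ.surfaceMeasure_apply hA', ← _root_.mul_assoc,
          ← ENNReal.ofReal_mul (by positivity), div_mul_cancel₀ _ hQ.ne']
        congr 2
        ext x
        have hx0 : G.dil a x = 0 ↔ x = 0 := by
          rw [← ρ.eq_zero_iff, ρ.dil_eq a ha, mul_eq_zero, or_iff_right ha.ne', ρ.eq_zero_iff]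
        simp only [hΦ, mem_inter_iff, mem_preimage, mem_prod, mem_Iio, mem_compl_iff,
          mem_singleton_iff, Set.mem_sdiff, ρ.mem_ball_zero, ρ.proj_dil ha, ρ.dil_eq a ha, hx0,
          mul_lt_iff_lt_one_right ha]
        tauto
  have hg : Measurable fun z : ℝ × (Fin N → ℝ) => f (G.dil z.1 z.2) := hf.comp G.measurable_dil
  have : SFinite ν := by
    rw [hν]
    infer_instance
  have h1 : ∫⁻ x, f x = ∫⁻ x in ({0}ᶜ : Set (Fin N → ℝ)), f (G.dil (Φ x).1 (Φ x).2) := by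
    conv_lhs => rw [← restrict_compl_singleton (μ := (volume : Measure (Fin N → ℝ))) 0]
    refine setLIntegral_congr_fun_ae (measurableSet_singleton _).compl ?_
    filter_upwards with x hx
    rw [hΦ]
    simp only [ρ.dil_proj hx]
  rw [h1, ← lintegral_map hg hΦm, ← hprod, lintegral_prod _ hg.aemeasurable, hν,
    lintegral_withDensity_eq_lintegral_mul _ hwm hg.lintegral_prod_right']
  refine lintegral_congr fun r => ?_
  have : ρ.surfaceMeasure.restrict ρ.sphere = ρ.surfaceMeasure :=
    Measure.restrict_eq_self_of_ae_mem (by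
      rw [ae_iff]
      exact ρ.surfaceMeasure_compl_sphere)
  rw [Pi.mul_apply, this, mul_comm]

/-- The weighted integral Hardy inequality with constant `C`,
`(∫_G |∫_{𝔹(0,|x|)} u(y) dy|^q |x|^β dx)^{1/q} ≤ C (∫_G |u(x)|^p |x|^α dx)^{1/p}`,
for all measurable `𝕜`-valued functions `u` on `G`. The outer integrals take values in `[0, ∞]`. -/
def HardyInequality (ρ : QuasiNorm G) (𝕜 : Type*) [RCLike 𝕜] (p q α β C : ℝ) : Prop :=
  ∀ u : (Fin N → ℝ) → 𝕜, Measurable u →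
    (∫⁻ x, ‖∫ y in ρ.ball 0 (ρ.toFun x), u y‖ₑ ^ q * ENNReal.ofReal (ρ.toFun x ^ β)) ^ (1 / q) ≤
      ENNReal.ofReal C *
        (∫⁻ x, ‖u x‖ₑ ^ p * ENNReal.ofReal (ρ.toFun x ^ α)) ^ (1 / p)

/-- The constant `C(p, q, Q, α)` for `p < q`, with `S = |𝔖|` and `p' = p / (p - 1)`. -/
noncomputable def hardyConst (S Q α p q : ℝ) : ℝ :=
  S ^ (1 + 1 / q - 1 / p) *
    ((p - 1) / (Q * (p - 1) - α)) ^ (1 / (p / (p - 1)) + 1 / q) *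
    ((p / (p - 1)) / q) ^ (1 / q) *
    (((q - p) / p * Real.Gamma (p * q / (q - p))) /
      (Real.Gamma (p / (q - p)) * Real.Gamma (p * (q - 1) / (q - p)))) ^ (1 / p - 1 / q)

end QuasiNorm

end HomogeneousGroup

/-!
Polar coordinates reduce the Hardy inequality on the group to one on the half-line. Replacing the
sphere average of `|u|` by its `L^p` average costs Hölder's inequality on the sphere, with equality
for radial `u`, and the change of radius `|x| = t ^ k`, `k = (p - 1) / (Q (p - 1) - α)`, removes the
weight on the right. What remains, for `F x = ∫₀ˣ f`, is Bliss's inequality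
`(∫₀^∞ x ^ (r - q) F ^ q) ^ (1/q) ≤ C (∫₀^∞ f ^ p) ^ (1/p)` with `r = q / p - 1`
(`lintegral_bliss`), or the classical Hardy inequality (`lintegral_hardy`) when `p = q`.

Bliss's inequality is proved with its sharp constant by monotone transport
(`IsRegularProfile.bliss`). For a regular `f`, let `T` be the increasing bijection of `(0, ∞)` that
carries the density `x ^ (r - q) F ^ q`, normalized, to the density `y ^ r (1 + y ^ r) ^ (-q / r)`
that belongs to the extremal function `y (1 + y ^ r) ^ (-1 / r)`. With `c = 1 - 1 / p`, consider

`P = F ^ (1 + q c) x ^ (-(q - r) c) T ^ (-r c)`.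

Its derivative is `(1 + q c) f φ`, with `φ = F ^ (q c) x ^ (-(q - r) c) T ^ (-r c)`, minus
`F ^ (1 + q c) x ^ (-(q - r) c) T ^ (-r c) ((q - r) c / x + r c T' / T)`. By the inequality between
weighted arithmetic and geometric means and the equation for `T'`, the subtracted term is at least
a multiple of `x ^ (r - q) F ^ q (1 + T ^ (-r))`, whose integral is found by substituting `y = T x`.
Since `P` vanishes at the origin and is nonnegative, this bounds `∫ f φ` from below. Hölder's
inequality bounds it from above, because `φ ^ p' = x ^ (r - q) F ^ q T ^ (-r)` is integrated by the
same substitution. Approximation in `L^p` and Fatou's lemma extend the result to all measurable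
functions (`lintegral_hardy_of_regular`).

Radial functions (`HardyInequality.radial`) give the converse statements: the extremal function and
the powers near the critical one show that the constants are least, dilates of an annulus force the
balance condition, and a truncation of `|x| ^ (-Q)` forces `α < Q (p - 1)`. The limit of the
constants as `s → q` follows from the leading order of Stirling's formula (`tendsto_log_Gamma_div`).
-/

/-! ### Primitives and monotone transport on the half-line -/

theorem intervalIntegrable_zero_of_integrableOn_Ioi {h : ℝ → ℝ} (hi : IntegrableOn h (Ioi 0))
    {x : ℝ} (hx : 0 ≤ x) : IntervalIntegrable h volume 0 x :=
  (intervalIntegrable_iff_integrableOn_Ioc_of_le hx).2 (hi.mono_set Ioc_subset_Ioi_self)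

theorem hasDerivAt_primitive_Ioi {h : ℝ → ℝ} (hc : ContinuousOn h (Ioi 0))
    (hi : IntegrableOn h (Ioi 0)) {x : ℝ} (hx : 0 < x) :
    HasDerivAt (fun x => ∫ t in (0 : ℝ)..x, h t) (h x) x :=
  intervalIntegral.integral_hasDerivAt_right
    (intervalIntegrable_zero_of_integrableOn_Ioi hi hx.le)
    (hc.stronglyMeasurableAtFilter isOpen_Ioi x hx) (hc.continuousAt (Ioi_mem_nhds hx))

theorem strictMonoOn_primitive_Ioi {h : ℝ → ℝ} (hi : IntegrableOn h (Ioi 0))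
    (hpos : ∀ x, 0 < x → 0 < h x) :
    StrictMonoOn (fun x => ∫ t in (0 : ℝ)..x, h t) (Ici 0) := by
  intro x hx y hy hxy
  have h1 := intervalIntegrable_zero_of_integrableOn_Ioi hi hx
  have h2 := intervalIntegrable_zero_of_integrableOn_Ioi hi hy
  have h3 : 0 < ∫ t in x..y, h t :=
    intervalIntegral.intervalIntegral_pos_of_pos_on (h1.symm.trans h2)
      (fun t ht => hpos t (lt_of_le_of_lt hx ht.1)) hxy
  have h4 := intervalIntegral.integral_add_adjacent_intervals h1 (h1.symm.trans h2)
  simp only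
  linarith

/-- The primitive of a positive integrable density maps `(0, ∞)` onto the open interval from `0`
to the total mass. -/
theorem image_primitive_Ioi {h : ℝ → ℝ} (hi : IntegrableOn h (Ioi 0))
    (hpos : ∀ x, 0 < x → 0 < h x) :
    (fun x => ∫ t in (0 : ℝ)..x, h t) '' Ioi 0 = Ioo 0 (∫ t in Ioi 0, h t) := by
  have hmono := strictMonoOn_primitive_Ioi hi hpos
  have hlim : Tendsto (fun x => ∫ t in (0 : ℝ)..x, h t) atTop (𝓝 (∫ t in Ioi 0, h t)) :=
    intervalIntegral_tendsto_integral_Ioi 0 hi tendsto_id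
  have hz : (∫ t in (0 : ℝ)..0, h t) = 0 := intervalIntegral.integral_same
  apply Subset.antisymm
  · rintro _ ⟨x, hx, rfl⟩
    have hx0 : (0 : ℝ) < x := hx
    have h1 := hmono self_mem_Ici hx0.le hx0
    have h2 := hmono hx0.le (by simp; linarith : x + 1 ∈ Ici (0 : ℝ)) (lt_add_one x)
    have h3 : (∫ t in (0 : ℝ)..(x + 1), h t) ≤ ∫ t in Ioi 0, h t := by
      refine ge_of_tendsto hlim ?_
      filter_upwards [eventually_ge_atTop (x + 1)] with y hy
      exact hmono.monotoneOn (by simp; linarith : x + 1 ∈ Ici (0 : ℝ))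
        (by simp; linarith : y ∈ Ici (0 : ℝ)) hy
    simp only at h1 h2
    rw [hz] at h1
    exact ⟨h1, h2.trans_le h3⟩
  · rintro y ⟨hy0, hy1⟩
    obtain ⟨X, hX, hX0⟩ := ((hlim.eventually (lt_mem_nhds hy1)).and (eventually_gt_atTop 0)).exists
    have hcont : ContinuousOn (fun x => ∫ t in (0 : ℝ)..x, h t) (Icc 0 X) := by
      have := intervalIntegral.continuousOn_primitive_interval (μ := volume) (f := h) (a := 0)
        (b := X) ?_
      · rwa [uIcc_of_le hX0.le] at this
      · rw [uIcc_of_le hX0.le]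
        exact (intervalIntegrable_iff_integrableOn_Icc_of_le hX0.le).1
          (intervalIntegrable_zero_of_integrableOn_Ioi hi hX0.le)
    obtain ⟨x, hx, hxy⟩ := intermediate_value_Icc hX0.le hcont
      (show y ∈ Icc _ _ by simp only [hz]; exact ⟨hy0.le, hX.le⟩)
    refine ⟨x, lt_of_le_of_ne hx.1 ?_, hxy⟩
    rintro rfl
    simp only [hz] at hxy
    exact hy0.ne hxy

/-- Monotone transport on the half-line: two positive continuous densities of equal total mass are
carried onto each other by an increasing differentiable bijection of `(0, ∞)`. -/
theorem exists_monotone_transport {h k : ℝ → ℝ} (hc : ContinuousOn h (Ioi 0))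
    (hi : IntegrableOn h (Ioi 0)) (hpos : ∀ x, 0 < x → 0 < h x) (kc : ContinuousOn k (Ioi 0))
    (ki : IntegrableOn k (Ioi 0)) (kpos : ∀ x, 0 < x → 0 < k x)
    (hk : ∫ t in Ioi 0, k t = ∫ t in Ioi 0, h t) :
    ∃ T : ℝ → ℝ, T '' Ioi 0 = Ioi 0 ∧ StrictMonoOn T (Ioi 0) ∧
      (∀ x, 0 < x → HasDerivAt T (k x / h (T x)) x) ∧
      ∀ x, 0 < x → ∫ t in (0 : ℝ)..T x, h t = ∫ t in (0 : ℝ)..x, k t := by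
  set H : ℝ → ℝ := fun x => ∫ t in (0 : ℝ)..x, h t with hH
  set K : ℝ → ℝ := fun x => ∫ t in (0 : ℝ)..x, k t with hK
  have Him : H '' Ioi 0 = Ioo 0 (∫ t in Ioi 0, h t) := image_primitive_Ioi hi hpos
  have Kim : K '' Ioi 0 = Ioo 0 (∫ t in Ioi 0, h t) := hk ▸ image_primitive_Ioi ki kpos
  have Hm : StrictMonoOn H (Ioi 0) := (strictMonoOn_primitive_Ioi hi hpos).mono Ioi_subset_Ici_self
  have Km : StrictMonoOn K (Ioi 0) := (strictMonoOn_primitive_Ioi ki kpos).mono Ioi_subset_Ici_self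
  have hex : ∀ x, 0 < x → ∃ y, 0 < y ∧ H y = K x := by
    intro x hx
    have : K x ∈ H '' Ioi 0 := by rw [Him, ← Kim]; exact mem_image_of_mem K hx
    exact this
  choose! T Tpos hT using hex
  have Tm : StrictMonoOn T (Ioi 0) := by
    intro x hx y hy hxy
    refine (Hm.lt_iff_lt (Tpos x hx) (Tpos y hy)).1 ?_
    rw [hT x hx, hT y hy]
    exact Km hx hy hxy
  have Tim : T '' Ioi 0 = Ioi 0 := by
    apply Subset.antisymm
    · rintro _ ⟨x, hx, rfl⟩
      exact Tpos x hx
    · intro y hy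
      have : H y ∈ K '' Ioi 0 := by rw [Kim, ← Him]; exact mem_image_of_mem H hy
      obtain ⟨x, hx, hxy⟩ := this
      exact ⟨x, hx, Hm.injOn (Tpos x hx) hy ((hT x hx).trans hxy)⟩
  refine ⟨T, Tim, Tm, fun x hx => ?_, hT⟩
  have Tc : ContinuousAt T x := continuousAt_of_monotoneOn_of_image_mem_nhds Tm.monotoneOn
    (Ioi_mem_nhds hx) (by rw [Tim]; exact Ioi_mem_nhds (Tpos x hx))
  -- The derivative of `T` is read off from `H ∘ T = K` through the slopes of `H` at `T x`.
  have hHd : HasDerivAt H (h (T x)) (T x) := hasDerivAt_primitive_Ioi hc hi (Tpos x hx)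
  have hKd : HasDerivAt K (k x) x := hasDerivAt_primitive_Ioi kc ki hx
  rw [hasDerivAt_iff_tendsto_slope] at hHd hKd ⊢
  have hTne : Tendsto T (𝓝[≠] x) (𝓝[≠] (T x)) := by
    refine tendsto_nhdsWithin_iff.2 ⟨Tc.tendsto.mono_left nhdsWithin_le_nhds, ?_⟩
    filter_upwards [self_mem_nhdsWithin, mem_nhdsWithin_of_mem_nhds (Ioi_mem_nhds hx)] with y hy hy0
    exact fun h => hy (Tm.injOn hy0 hx h)
  refine (hKd.div (hHd.comp hTne) (hpos _ (Tpos x hx)).ne').congr' ?_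
  filter_upwards [self_mem_nhdsWithin, mem_nhdsWithin_of_mem_nhds (Ioi_mem_nhds hx)] with y hy hy0
  have h1 : y - x ≠ 0 := sub_ne_zero.2 hy
  have h2 : T y - T x ≠ 0 := sub_ne_zero.2 fun h => hy (Tm.injOn hy0 hx h)
  have h3 : K y - K x ≠ 0 := sub_ne_zero.2 fun h => hy (Km.injOn hy0 hx h)
  simp only [Pi.div_apply, Function.comp, slope_def_field, hT y hy0, hT x hx]
  field_simp

/-- Integrated form of the differential inequality `P' ≤ g - k` on `(0, ∞)`. Since `P ≥ 0`, its
boundary term at infinity may be dropped, and no integrability of `P'` is needed. -/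
theorem integral_Ioi_le_of_hasDerivAt {P P' g k : ℝ → ℝ}
    (hP : ∀ x, 0 < x → HasDerivAt P (P' x) x)
    (hP0 : ∀ x, 0 < x → 0 ≤ P x) (hlim : Tendsto P (𝓝[>] 0) (𝓝 0))
    (gi : IntegrableOn g (Ioi 0)) (ki : IntegrableOn k (Ioi 0))
    (hle : ∀ x, 0 < x → P' x + k x ≤ g x) :
    ∫ x in Ioi 0, k x ≤ ∫ x in Ioi 0, g x := by
  set s : ℕ → Set ℝ := fun n => Ioc (1 / ((n : ℝ) + 1)) (n + 1) with hs
  have hU : ⋃ n, s n = Ioi 0 := by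
    apply Subset.antisymm
    · refine iUnion_subset fun n x hx => ?_
      exact lt_trans (by positivity) hx.1
    · intro x hx
      obtain ⟨n, hn⟩ := exists_nat_gt (max x x⁻¹)
      refine mem_iUnion.2 ⟨n, ?_, ?_⟩
      · rw [one_div]
        exact inv_lt_of_inv_lt₀ hx (by linarith [le_max_right x x⁻¹])
      · linarith [le_max_left x x⁻¹]
  have hmono : Monotone s := by
    intro m n hmn
    have : (m : ℝ) ≤ n := by exact_mod_cast hmn
    exact Ioc_subset_Ioc (one_div_le_one_div_of_le (by positivity) (by linarith)) (by linarith)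
  have hsub : IntegrableOn (fun x => g x - k x) (Ioi 0) := gi.sub ki
  have hT := tendsto_setIntegral_of_monotone (fun n => measurableSet_Ioc) hmono
    (hU ▸ hsub : IntegrableOn (fun x => g x - k x) (⋃ n, s n) volume)
  have hPn : Tendsto (fun n : ℕ => -P (1 / ((n : ℝ) + 1))) atTop (𝓝 (-0)) := by
    refine (hlim.comp (tendsto_nhdsWithin_iff.2 ⟨tendsto_one_div_add_atTop_nhds_zero_nat, ?_⟩)).neg
    exact Eventually.of_forall fun n => by simp only [mem_Ioi]; positivity
  have key : 0 ≤ ∫ x in Ioi 0, (g x - k x) := by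
    rw [neg_zero] at hPn
    rw [← hU]
    refine le_of_tendsto_of_tendsto' hPn hT fun n => ?_
    have hn0 : (0 : ℝ) < 1 / ((n : ℝ) + 1) := by positivity
    have hn1 : 1 / ((n : ℝ) + 1) ≤ n + 1 := by
      rw [div_le_iff₀ (by positivity)]
      nlinarith [Nat.cast_nonneg (α := ℝ) n]
    have := intervalIntegral.sub_le_integral_of_hasDeriv_right_of_le hn1 (g := P) (g' := P')
      (φ := fun x => g x - k x)
      (fun x hx => (hP x (hn0.trans_le hx.1)).continuousAt.continuousWithinAt)
      (fun x hx => (hP x (hn0.trans hx.1)).hasDerivWithinAt)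
      (hsub.mono_set fun x hx => hn0.trans_le hx.1)
      (fun x hx => by linarith [hle x (hn0.trans hx.1)])
    rw [intervalIntegral.integral_of_le hn1] at this
    linarith [hP0 (n + 1) (by positivity)]
  rw [integral_sub gi ki] at key
  linarith

/-! ### A beta integral on the half-line -/

theorem lintegral_rpow_mul_exp_neg_mul_Ioi {a s : ℝ} (ha : 0 < a) (hs : 0 < s) :
    ∫⁻ t in Ioi (0 : ℝ), ENNReal.ofReal (t ^ (a - 1) * Real.exp (-(s * t))) =
      ENNReal.ofReal ((1 / s) ^ a * Real.Gamma a) := by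
  have hi : IntegrableOn (fun t : ℝ => t ^ (a - 1) * Real.exp (-(s * t))) (Ioi 0) := by
    have := Real.integral_rpow_mul_exp_neg_mul_Ioi ha hs
    by_contra h
    rw [integral_undef h] at this
    have : 0 < (1 / s) ^ a * Real.Gamma a :=
      mul_pos (Real.rpow_pos_of_pos (by positivity) _) (Real.Gamma_pos_of_pos ha)
    linarith
  rw [← Real.integral_rpow_mul_exp_neg_mul_Ioi ha hs, ofReal_integral_eq_lintegral_ofReal hi]
  filter_upwards [ae_restrict_mem measurableSet_Ioi] with t ht
  exact mul_nonneg (Real.rpow_nonneg (le_of_lt ht) _) (Real.exp_nonneg _)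

/-- The beta integral in the form `∫₀^∞ v^{a-1} (1+v)^{-(a+b)} dv = B(a, b)`, obtained by writing
`Γ(a+b) (1+v)^{-(a+b)}` as a Laplace transform and exchanging the integrals. -/
theorem lintegral_rpow_mul_one_add_rpow {a b : ℝ} (ha : 0 < a) (hb : 0 < b) :
    ∫⁻ v in Ioi (0 : ℝ), ENNReal.ofReal (v ^ (a - 1) * (1 + v) ^ (-(a + b))) =
      ENNReal.ofReal (Real.Gamma a * Real.Gamma b / Real.Gamma (a + b)) := by
  have hG : 0 < Real.Gamma (a + b) := Real.Gamma_pos_of_pos (by linarith)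
  have hGa : 0 < Real.Gamma a := Real.Gamma_pos_of_pos ha
  have key : ENNReal.ofReal (Real.Gamma (a + b)) *
      ∫⁻ v in Ioi (0 : ℝ), ENNReal.ofReal (v ^ (a - 1) * (1 + v) ^ (-(a + b))) =
      ENNReal.ofReal (Real.Gamma a * Real.Gamma b) := by
    rw [← lintegral_const_mul _ (by fun_prop)]
    calc ∫⁻ v in Ioi (0 : ℝ), ENNReal.ofReal (Real.Gamma (a + b)) *
          ENNReal.ofReal (v ^ (a - 1) * (1 + v) ^ (-(a + b)))
        = ∫⁻ v in Ioi (0 : ℝ), ∫⁻ t in Ioi (0 : ℝ), ENNReal.ofReal (v ^ (a - 1)) *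
            ENNReal.ofReal (t ^ (a + b - 1) * Real.exp (-((1 + v) * t))) := by
          refine setLIntegral_congr_fun measurableSet_Ioi fun v hv => ?_
          have hv : (0 : ℝ) < v := hv
          rw [lintegral_const_mul _ (by fun_prop),
            lintegral_rpow_mul_exp_neg_mul_Ioi (by linarith) (by linarith),
            ← ENNReal.ofReal_mul hG.le, ← ENNReal.ofReal_mul (Real.rpow_nonneg hv.le _),
            Real.rpow_neg (by linarith), one_div, Real.inv_rpow (by linarith)]
          congr 1
          ring
      _ = ∫⁻ t in Ioi (0 : ℝ), ∫⁻ v in Ioi (0 : ℝ), ENNReal.ofReal (v ^ (a - 1)) *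
            ENNReal.ofReal (t ^ (a + b - 1) * Real.exp (-((1 + v) * t))) :=
          lintegral_lintegral_swap (by fun_prop)
      _ = ∫⁻ t in Ioi (0 : ℝ), ENNReal.ofReal (Real.Gamma a) *
            ENNReal.ofReal (t ^ (b - 1) * Real.exp (-(1 * t))) := by
          refine setLIntegral_congr_fun measurableSet_Ioi fun t ht => ?_
          have ht : (0 : ℝ) < t := ht
          calc ∫⁻ v in Ioi (0 : ℝ), ENNReal.ofReal (v ^ (a - 1)) *
                ENNReal.ofReal (t ^ (a + b - 1) * Real.exp (-((1 + v) * t)))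
              = ∫⁻ v in Ioi (0 : ℝ), ENNReal.ofReal (t ^ (a + b - 1) * Real.exp (-t)) *
                ENNReal.ofReal (v ^ (a - 1) * Real.exp (-(t * v))) := by
                refine setLIntegral_congr_fun measurableSet_Ioi fun v hv => ?_
                have hv : (0 : ℝ) < v := hv
                rw [← ENNReal.ofReal_mul (Real.rpow_nonneg hv.le _),
                  ← ENNReal.ofReal_mul (by positivity)]
                congr 1
                rw [show -((1 + v) * t) = -t + -(t * v) by ring, Real.exp_add]
                ring
            _ = _ := by
                rw [lintegral_const_mul _ (by fun_prop), lintegral_rpow_mul_exp_neg_mul_Ioi ha ht,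
                  ← ENNReal.ofReal_mul (by positivity), ← ENNReal.ofReal_mul hGa.le]
                congr 1
                rw [one_div, Real.inv_rpow ht.le, show a + b - 1 = a + (b - 1) by ring,
                  Real.rpow_add ht, one_mul]
                have := (Real.rpow_pos_of_pos ht a).ne'
                field_simp
      _ = _ := by
          rw [lintegral_const_mul _ (by fun_prop), lintegral_rpow_mul_exp_neg_mul_Ioi hb one_pos,
            ← ENNReal.ofReal_mul hGa.le]
          simp
  rw [ENNReal.ofReal_div_of_pos hG, ← key, mul_comm, ENNReal.mul_div_cancel_right]
  · simpa using hG
  · exact ENNReal.ofReal_ne_top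

theorem lintegral_comp_rpow_mul_Ioi {k : ℝ} (hk : 0 < k) (g : ℝ → ℝ≥0∞) :
    ∫⁻ v in Ioi (0 : ℝ), g v =
      ∫⁻ t in Ioi (0 : ℝ), ENNReal.ofReal (k * t ^ (k - 1)) * g (t ^ k) := by
  have him : (fun t : ℝ => t ^ k) '' Ioi 0 = Ioi 0 := by
    apply Subset.antisymm
    · rintro _ ⟨t, ht, rfl⟩
      exact Real.rpow_pos_of_pos ht k
    · intro v hv
      exact ⟨v ^ k⁻¹, Real.rpow_pos_of_pos hv _, Real.rpow_inv_rpow (le_of_lt hv) hk.ne'⟩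
  have h := lintegral_image_eq_lintegral_abs_deriv_mul (f := fun t : ℝ => t ^ k)
    (f' := fun t => k * t ^ (k - 1)) (s := Ioi 0) measurableSet_Ioi
    (fun t ht => (Real.hasDerivAt_rpow_const (Or.inl (ne_of_gt ht))).hasDerivWithinAt)
    (fun s hs t ht h => (Real.rpow_left_inj (le_of_lt hs) (le_of_lt ht) hk.ne').1 h) g
  rw [him] at h
  rw [h]
  refine setLIntegral_congr_fun measurableSet_Ioi fun t ht => ?_
  have ht : (0 : ℝ) < t := ht
  rw [abs_of_nonneg (by positivity)]

/-- The beta integral after the substitution `v = y ^ r`. -/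
theorem lintegral_rpow_mul_one_add_rpow_rpow {r m d : ℝ} (hr : 0 < r) (hm : 0 < m + 1)
    (hd : (m + 1) / r < d) :
    ∫⁻ y in Ioi (0 : ℝ), ENNReal.ofReal (y ^ m * (1 + y ^ r) ^ (-d)) =
      ENNReal.ofReal (Real.Gamma ((m + 1) / r) * Real.Gamma (d - (m + 1) / r) /
        (r * Real.Gamma d)) := by
  have h := lintegral_rpow_mul_one_add_rpow (a := (m + 1) / r) (b := d - (m + 1) / r)
    (by positivity) (by linarith)
  rw [lintegral_comp_rpow_mul_Ioi hr] at h
  have h2 : ∫⁻ t in Ioi (0 : ℝ), ENNReal.ofReal (r * t ^ (r - 1)) *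
      ENNReal.ofReal ((t ^ r) ^ ((m + 1) / r - 1) *
        (1 + t ^ r) ^ (-((m + 1) / r + (d - (m + 1) / r)))) =
      ENNReal.ofReal r * ∫⁻ y in Ioi (0 : ℝ), ENNReal.ofReal (y ^ m * (1 + y ^ r) ^ (-d)) := by
    rw [← lintegral_const_mul _ (by fun_prop)]
    refine setLIntegral_congr_fun measurableSet_Ioi fun t ht => ?_
    have ht : (0 : ℝ) < t := ht
    rw [← ENNReal.ofReal_mul (by positivity), ← ENNReal.ofReal_mul hr.le, ← Real.rpow_mul ht.le,
      add_sub_cancel, show m = (r - 1) + r * ((m + 1) / r - 1) by field_simp; ring,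
      Real.rpow_add ht]
    congr 1
    rw [show r - 1 + r * ((m + 1) / r - 1) + 1 = m + 1 by field_simp; ring]
    ring
  rw [h2, add_sub_cancel] at h
  have hr' : ENNReal.ofReal r ≠ 0 := by simpa using hr
  rw [← ENNReal.mul_right_inj hr' ENNReal.ofReal_ne_top, h, ← ENNReal.ofReal_mul hr.le]
  congr 1
  field_simp

theorem integrableOn_rpow_mul_one_add_rpow_rpow {r m d : ℝ} (hr : 0 < r) (hm : 0 < m + 1)
    (hd : (m + 1) / r < d) :
    IntegrableOn (fun y : ℝ => y ^ m * (1 + y ^ r) ^ (-d)) (Ioi 0) := by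
  refine (lintegral_ofReal_ne_top_iff_integrable (by fun_prop) ?_).1 ?_
  · filter_upwards [ae_restrict_mem measurableSet_Ioi] with t ht
    have ht : (0 : ℝ) < t := ht
    simp only [Pi.zero_apply]
    positivity
  · rw [lintegral_rpow_mul_one_add_rpow_rpow hr hm hd]
    exact ENNReal.ofReal_ne_top

theorem integral_rpow_mul_one_add_rpow_rpow {r m d : ℝ} (hr : 0 < r) (hm : 0 < m + 1)
    (hd : (m + 1) / r < d) :
    ∫ y in Ioi (0 : ℝ), y ^ m * (1 + y ^ r) ^ (-d) =
      Real.Gamma ((m + 1) / r) * Real.Gamma (d - (m + 1) / r) / (r * Real.Gamma d) := by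
  have h1 : 0 < (m + 1) / r := by positivity
  have h2 := Real.Gamma_pos_of_pos h1
  have h3 := Real.Gamma_pos_of_pos (sub_pos.2 hd)
  have h4 := Real.Gamma_pos_of_pos (h1.trans hd)
  rw [integral_eq_lintegral_of_nonneg_ae, lintegral_rpow_mul_one_add_rpow_rpow hr hm hd,
    ENNReal.toReal_ofReal (by positivity)]
  · filter_upwards [ae_restrict_mem measurableSet_Ioi] with t ht
    have ht : (0 : ℝ) < t := ht
    simp only [Pi.zero_apply]
    positivity
  · fun_prop

/-! ### One-dimensional inequalities for regular profiles -/

/-- The class of functions on the half-line for which the one-dimensional inequalities are proved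
by calculus: continuous, positive, bounded and integrable. Positivity up to the origin makes the
primitive comparable to the identity there. -/
structure IsRegularProfile (f : ℝ → ℝ) : Prop where
  continuous : Continuous f
  pos : ∀ x, 0 < f x
  bounded : ∃ B, ∀ x, f x ≤ B
  integrableOn : IntegrableOn f (Ioi 0)

namespace IsRegularProfile

variable {f : ℝ → ℝ}

theorem hasDerivAt_primitive (hf : IsRegularProfile f) (x : ℝ) :
    HasDerivAt (fun x => ∫ t in (0 : ℝ)..x, f t) (f x) x :=
  intervalIntegral.integral_hasDerivAt_right (hf.continuous.intervalIntegrable _ _)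
    (hf.continuous.stronglyMeasurableAtFilter _ _) hf.continuous.continuousAt

theorem primitive_pos (hf : IsRegularProfile f) {x : ℝ} (hx : 0 < x) :
    0 < ∫ t in (0 : ℝ)..x, f t :=
  intervalIntegral.intervalIntegral_pos_of_pos (hf.continuous.intervalIntegrable _ _) hf.pos hx

theorem exists_primitive_le_mul (hf : IsRegularProfile f) :
    ∃ B, 0 < B ∧ ∀ x, 0 < x → ∫ t in (0 : ℝ)..x, f t ≤ B * x := by
  obtain ⟨B, hB⟩ := hf.bounded
  refine ⟨B, (hf.pos 0).trans_le (hB 0), fun x hx => ?_⟩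
  have := intervalIntegral.integral_mono_on (μ := volume) hx.le
    (hf.continuous.intervalIntegrable 0 x)
    (intervalIntegrable_const (c := B)) fun t _ => hB t
  simpa [mul_comm] using this

theorem exists_primitive_le (hf : IsRegularProfile f) :
    ∃ M, 0 < M ∧ ∀ x, 0 < x → ∫ t in (0 : ℝ)..x, f t ≤ M := by
  have h : ∀ x, 0 < x → ∫ t in (0 : ℝ)..x, f t ≤ ∫ t in Ioi 0, f t := fun x hx => by
    rw [intervalIntegral.integral_of_le hx.le]
    exact setIntegral_mono_set hf.integrableOn (Eventually.of_forall fun t => (hf.pos t).le)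
      Ioc_subset_Ioi_self.eventuallyLE
  exact ⟨_, (hf.primitive_pos one_pos).trans_le (h 1 one_pos), h⟩

theorem exists_mul_le_primitive (hf : IsRegularProfile f) :
    ∃ A, 0 < A ∧ ∀ x, 0 < x → x ≤ 1 → A * x ≤ ∫ t in (0 : ℝ)..x, f t := by
  obtain ⟨z, -, hz⟩ := (isCompact_Icc (a := (0 : ℝ)) (b := 1)).exists_isMinOn
    ⟨0, by simp⟩ hf.continuous.continuousOn
  refine ⟨f z, hf.pos z, fun x hx hx1 => ?_⟩
  have := intervalIntegral.integral_mono_on (μ := volume) hx.le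
    (intervalIntegrable_const (c := f z))
    (hf.continuous.intervalIntegrable 0 x) fun t ht => hz ⟨ht.1, ht.2.trans hx1⟩
  simpa [mul_comm] using this

theorem integrableOn_rpow (hf : IsRegularProfile f) {p : ℝ} (hp : 1 ≤ p) :
    IntegrableOn (fun x => f x ^ p) (Ioi 0) := by
  obtain ⟨B, hB⟩ := hf.bounded
  refine Integrable.mono' (hf.integrableOn.const_mul (B ^ (p - 1)))
    (hf.continuous.rpow_const fun x => Or.inl (hf.pos x).ne').aestronglyMeasurable
    (Eventually.of_forall fun x => ?_)
  rw [Real.norm_of_nonneg (Real.rpow_nonneg (hf.pos x).le _)]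
  calc f x ^ p = f x ^ (p - 1) * f x := by
        rw [← Real.rpow_add_one (hf.pos x).ne', sub_add_cancel]
    _ ≤ B ^ (p - 1) * f x := by
        have := hf.pos x
        gcongr
        exact hB x

theorem continuous_primitive (hf : IsRegularProfile f) :
    Continuous fun x => ∫ t in (0 : ℝ)..x, f t :=
  continuous_iff_continuousAt.2 fun x => (hf.hasDerivAt_primitive x).continuousAt

theorem integrableOn_primitive (hf : IsRegularProfile f) {r q : ℝ} (hr : 0 ≤ r) (hq : 0 < q)
    (hrq : r - q < -1) :
    IntegrableOn (fun x => x ^ (r - q) * (∫ t in (0 : ℝ)..x, f t) ^ q) (Ioi 0) := by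
  obtain ⟨B, hB0, hB⟩ := hf.exists_primitive_le_mul
  obtain ⟨M, hM0, hM⟩ := hf.exists_primitive_le
  have hmeas : ∀ s : Set ℝ, AEStronglyMeasurable
      (fun x => x ^ (r - q) * (∫ t in (0 : ℝ)..x, f t) ^ q) (volume.restrict s) := fun s =>
    ((measurable_id.pow_const _).mul
      (hf.continuous_primitive.measurable.pow_const _)).aestronglyMeasurable
  rw [← Ioc_union_Ioi_eq_Ioi zero_le_one]
  refine IntegrableOn.union ?_ ?_
  · have h1 : IntegrableOn (fun x : ℝ => B ^ q * x ^ r) (Ioc 0 1) :=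
      ((intervalIntegrable_iff_integrableOn_Ioc_of_le zero_le_one).1
        (intervalIntegral.intervalIntegrable_rpow' (by linarith))).const_mul _
    refine Integrable.mono' h1 (hmeas _) ?_
    filter_upwards [ae_restrict_mem measurableSet_Ioc] with x hx
    have hF := hf.primitive_pos hx.1
    have hx0 := hx.1
    rw [Real.norm_of_nonneg (by positivity)]
    calc x ^ (r - q) * (∫ t in (0 : ℝ)..x, f t) ^ q ≤ x ^ (r - q) * (B * x) ^ q := by
          gcongr
          exact hB x hx0
      _ = B ^ q * x ^ r := by
          rw [Real.mul_rpow hB0.le hx0.le, mul_left_comm, ← Real.rpow_add hx0, sub_add_cancel]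
  · refine Integrable.mono' ((integrableOn_Ioi_rpow_of_lt hrq one_pos).mul_const (M ^ q))
      (hmeas _) ?_
    filter_upwards [ae_restrict_mem measurableSet_Ioi] with x hx
    have hx0 : (0 : ℝ) < x := zero_lt_one.trans hx
    have hF := hf.primitive_pos hx0
    rw [Real.norm_of_nonneg (by positivity)]
    gcongr
    exact hM x hx0

theorem integral_primitive_pos (hf : IsRegularProfile f) {r q : ℝ} (hr : 0 ≤ r) (hq : 0 < q)
    (hrq : r - q < -1) :
    0 < ∫ x in Ioi (0 : ℝ), x ^ (r - q) * (∫ t in (0 : ℝ)..x, f t) ^ q := by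
  rw [setIntegral_pos_iff_support_of_nonneg_ae _ (hf.integrableOn_primitive hr hq hrq)]
  · refine lt_of_lt_of_le (b := volume (Ioi (0 : ℝ))) (by simp) (measure_mono fun x hx => ?_)
    have hx0 : (0 : ℝ) < x := hx
    have hF := hf.primitive_pos hx0
    exact ⟨by rw [Function.mem_support]; positivity, hx⟩
  · filter_upwards [ae_restrict_mem measurableSet_Ioi] with x hx
    have hx0 : (0 : ℝ) < x := hx
    have hF := hf.primitive_pos hx0
    simp only [Pi.zero_apply]
    positivity

/-- Hölder's inequality against a weight `φ` with `φ ^ p' = ψ`. -/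
theorem integral_mul_le (hf : IsRegularProfile f) {p : ℝ} (hp : 1 < p) {φ ψ : ℝ → ℝ}
    (hφ : ∀ x, 0 < x → 0 < φ x) (hm : AEStronglyMeasurable φ (volume.restrict (Ioi 0)))
    (hψ : IntegrableOn ψ (Ioi 0)) (hφψ : ∀ x, 0 < x → φ x ^ (p / (p - 1)) = ψ x) :
    IntegrableOn (fun x => f x * φ x) (Ioi 0) ∧
    ∫ x in Ioi 0, f x * φ x ≤
      (∫ x in Ioi 0, f x ^ p) ^ (1 / p) * (∫ x in Ioi 0, ψ x) ^ (1 - 1 / p) := by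
  have hc : p.HolderConjugate (p / (p - 1)) := Real.HolderConjugate.conjExponent hp
  have hp0 : 0 < p := by linarith
  have hp1 : 0 < p / (p - 1) := div_pos hp0 (by linarith)
  have hfL : MemLp f (ENNReal.ofReal p) (volume.restrict (Ioi 0)) := by
    rw [← integrable_norm_rpow_iff hf.continuous.aestronglyMeasurable (by simpa using hp0)
      ENNReal.ofReal_ne_top, ENNReal.toReal_ofReal hp0.le]
    refine (hf.integrableOn_rpow hp.le).congr_fun (fun x _ => ?_) measurableSet_Ioi
    rw [Real.norm_of_nonneg (hf.pos x).le]
  have hφL : MemLp φ (ENNReal.ofReal (p / (p - 1))) (volume.restrict (Ioi 0)) := by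
    rw [← integrable_norm_rpow_iff hm (by simpa using hp1) ENNReal.ofReal_ne_top,
      ENNReal.toReal_ofReal hp1.le]
    refine hψ.congr_fun (fun x hx => ?_) measurableSet_Ioi
    rw [Real.norm_of_nonneg (hφ x hx).le, hφψ x hx]
  have hcE : ENNReal.HolderConjugate (ENNReal.ofReal p) (ENNReal.ofReal (p / (p - 1))) :=
    hc.ennrealOfReal
  refine ⟨hfL.integrable_mul hφL, ?_⟩
  have h := integral_mul_le_Lp_mul_Lq_of_nonneg hc (μ := volume.restrict (Ioi 0)) (f := f) (g := φ)
    (Eventually.of_forall fun x => (hf.pos x).le)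
    (by filter_upwards [ae_restrict_mem measurableSet_Ioi] with x hx using (hφ x hx).le) hfL hφL
  rw [setIntegral_congr_fun (g := ψ) measurableSet_Ioi fun x hx => hφψ x hx] at h
  convert h using 3
  field_simp

/-- Hardy's inequality for regular profiles: integrate the derivative of `F ^ p * x ^ (1 - p)`
and apply Hölder's inequality. -/
theorem hardy (hf : IsRegularProfile f) {p : ℝ} (hp : 1 < p) :
    (∫ x in Ioi (0 : ℝ), x ^ (0 - p) * (∫ t in (0 : ℝ)..x, f t) ^ p) ^ (1 / p) ≤
      p / (p - 1) * (∫ x in Ioi 0, f x ^ p) ^ (1 / p) := by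
  have hp0 : 0 < p := by linarith
  have hp1 : 0 < p - 1 := by linarith
  have hIi := hf.integrableOn_primitive (r := 0) le_rfl hp0 (by linarith)
  have hIpos := hf.integral_primitive_pos (r := 0) le_rfl hp0 (by linarith)
  set F : ℝ → ℝ := fun x => ∫ t in (0 : ℝ)..x, f t with hF
  set I := ∫ x in Ioi (0 : ℝ), x ^ (0 - p) * F x ^ p with hI
  have hFpos : ∀ x, 0 < x → 0 < F x := fun x hx => hf.primitive_pos hx
  have hFm : Measurable F := hf.continuous_primitive.measurable
  obtain ⟨hfi, hfle⟩ := hf.integral_mul_le hp (φ := fun x => x ^ (1 - p) * F x ^ (p - 1))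
    (ψ := fun x => x ^ (0 - p) * F x ^ p)
    (fun x hx => by have := hFpos x hx; positivity)
    ((measurable_id.pow_const _).mul (hFm.pow_const _)).aestronglyMeasurable hIi
    (fun x hx => by
      have := hFpos x hx
      rw [Real.mul_rpow (by positivity) (by positivity), ← Real.rpow_mul hx.le,
        ← Real.rpow_mul this.le]
      congr 2
      · field_simp
        ring
      · field_simp)
  have key : ∫ x in Ioi (0 : ℝ), (p - 1) * (x ^ (0 - p) * F x ^ p) ≤
      ∫ x in Ioi (0 : ℝ), p * (f x * (x ^ (1 - p) * F x ^ (p - 1))) := by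
    refine integral_Ioi_le_of_hasDerivAt (P := fun x => F x ^ p * x ^ (1 - p))
      (P' := fun x => f x * p * F x ^ (p - 1) * x ^ (1 - p) +
        F x ^ p * ((1 - p) * x ^ (1 - p - 1)))
      (fun x hx => ?_) (fun x hx => ?_) ?_ (hfi.const_mul p) (hIi.const_mul (p - 1))
      fun x hx => le_of_eq ?_
    · exact ((hf.hasDerivAt_primitive x).rpow_const (Or.inl (hFpos x hx).ne')).mul
        (Real.hasDerivAt_rpow_const (Or.inl hx.ne'))
    · have := hFpos x hx
      positivity
    · obtain ⟨B, hB0, hB⟩ := hf.exists_primitive_le_mul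
      have hlim : Tendsto (fun x : ℝ => B ^ p * x) (𝓝[>] 0) (𝓝 0) := by
        have : Tendsto (fun x : ℝ => B ^ p * x) (𝓝 0) (𝓝 (B ^ p * 0)) :=
          tendsto_id.const_mul _
        rw [mul_zero] at this
        exact this.mono_left nhdsWithin_le_nhds
      refine squeeze_zero' ?_ ?_ hlim
      · filter_upwards [self_mem_nhdsWithin] with x (hx : (0 : ℝ) < x)
        have := hFpos x hx
        positivity
      · filter_upwards [self_mem_nhdsWithin] with x (hx : (0 : ℝ) < x)
        have := hFpos x hx
        calc F x ^ p * x ^ (1 - p) ≤ (B * x) ^ p * x ^ (1 - p) := by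
              gcongr
              exact hB x hx
          _ = B ^ p * x := by
              rw [Real.mul_rpow hB0.le hx.le, mul_assoc, ← Real.rpow_add hx, add_sub_cancel,
                Real.rpow_one]
    · rw [show 1 - p - 1 = 0 - p by ring]
      ring
  rw [integral_const_mul, integral_const_mul] at key
  set N := (∫ x in Ioi 0, f x ^ p) ^ (1 / p)
  have h1 : (p - 1) * I ≤ p * (N * I ^ (1 - 1 / p)) := key.trans (by gcongr)
  have h2 : I = I ^ (1 / p) * I ^ (1 - 1 / p) := by
    rw [← Real.rpow_add hIpos, add_sub_cancel, Real.rpow_one]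
  have h3 : 0 < I ^ (1 - 1 / p) := Real.rpow_pos_of_pos hIpos _
  have h4 : (p - 1) * I ^ (1 / p) ≤ p * N := by
    refine le_of_mul_le_mul_right ?_ h3
    calc (p - 1) * I ^ (1 / p) * I ^ (1 - 1 / p) = (p - 1) * I := by rw [mul_assoc, ← h2]
      _ ≤ _ := by linarith
  rw [div_mul_eq_mul_div, le_div_iff₀ hp1]
  linarith

end IsRegularProfile

/-! ### Bliss's inequality for regular profiles -/

/-- The mass `∫₀^∞ (1 + y ^ r) ^ (-q / r) dy`, which is `∫₀^∞ g ^ p` for the extremal function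
`g = (1 + y ^ r) ^ (-1 / r - 1)` of Bliss's inequality, where `r = q / p - 1`. The factor
`y ^ 0 = 1` puts it in the form of the beta integral above. -/
noncomputable def blissMass (q r : ℝ) : ℝ :=
  ∫ y in Ioi (0 : ℝ), y ^ (0 : ℝ) * (1 + y ^ r) ^ (-(q / r))

theorem blissMass_eq {q r : ℝ} (hr : 0 < r) (hq : 1 < q) :
    blissMass q r = Real.Gamma (1 / r) * Real.Gamma ((q - 1) / r) / (r * Real.Gamma (q / r)) := by
  rw [blissMass, integral_rpow_mul_one_add_rpow_rpow hr (by norm_num)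
    (by rw [zero_add]; gcongr), zero_add, ← sub_div]

theorem blissMass_pos {q r : ℝ} (hr : 0 < r) (hq : 1 < q) : 0 < blissMass q r := by
  rw [blissMass_eq hr hq]
  have h1 : 0 < Real.Gamma (1 / r) := Real.Gamma_pos_of_pos (by positivity)
  have h2 : 0 < Real.Gamma ((q - 1) / r) :=
    Real.Gamma_pos_of_pos (div_pos (by linarith) hr)
  have h3 : 0 < Real.Gamma (q / r) := Real.Gamma_pos_of_pos (div_pos (by linarith) hr)
  positivity

theorem integrableOn_bliss {q r : ℝ} (hr : 0 < r) (hq : 1 + r < q) :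
    IntegrableOn (fun y : ℝ => y ^ r * (1 + y ^ r) ^ (-(q / r))) (Ioi 0) :=
  integrableOn_rpow_mul_one_add_rpow_rpow hr (by linarith) (by gcongr; linarith)

/-- The `q`-mass of the extremal function of Bliss's inequality, in terms of its `p`-mass. -/
theorem integral_bliss {q r : ℝ} (hr : 0 < r) (hq : 1 + r < q) :
    ∫ y in Ioi (0 : ℝ), y ^ r * (1 + y ^ r) ^ (-(q / r)) = blissMass q r / (q - 1 - r) := by
  have h0 : 0 < q - 1 - r := by linarith
  rw [blissMass_eq hr (by linarith), integral_rpow_mul_one_add_rpow_rpow hr (by linarith)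
    (by gcongr; linarith)]
  rw [show (r + 1) / r = 1 / r + 1 by field_simp; ring, Real.Gamma_add_one (by positivity),
    show (q - 1) / r = (q / r - (1 / r + 1)) + 1 by field_simp; ring,
    Real.Gamma_add_one (by
      rw [show q / r - (1 / r + 1) = (q - 1 - r) / r by field_simp; ring]; positivity)]
  have : 0 < Real.Gamma (q / r) := Real.Gamma_pos_of_pos (div_pos (by linarith) hr)
  field_simp
  rw [show q - (1 + r) = q - 1 - r by ring]
  field_simp

/-- The sharp constant in Bliss's inequality
`(∫₀^∞ x ^ (q/p - 1 - q) F ^ q) ^ (1/q) ≤ C (∫₀^∞ F' ^ p) ^ (1/p)`, `F 0 = 0`, written as the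
quotient of the two sides for the extremal function. -/
noncomputable def blissConst (p q : ℝ) : ℝ :=
  (p / (p - 1) / q) ^ (1 / q) * blissMass q (q / p - 1) ^ (1 / q - 1 / p)

/-- The weighted geometric mean of `x⁻¹` and `T' / T`, with weights `1 - r / q` and `r / q`, where
`T' = l * x ^ (r - q) * F ^ q / (T ^ r * (1 + T ^ r) ^ (-q / r))` is the equation for the transport
map: the exponents are such that all powers combine to `x ^ (r - q) * F ^ q * (1 + T ^ (-r))`. -/
theorem bliss_rpow_identity {p q r F x T l : ℝ} (hp : 1 < p) (hpq : p < q) (hr : r = q / p - 1)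
    (hF : 0 < F) (hx : 0 < x) (hT : 0 < T) (hl : 0 < l) :
    F ^ (1 + q * (1 - 1 / p)) * x ^ (-((q - r) * (1 - 1 / p))) * T ^ (-(r * (1 - 1 / p))) *
      (x⁻¹ ^ (1 - r / q) *
        (l * (x ^ (r - q) * F ^ q) / (T ^ r * (1 + T ^ r) ^ (-(q / r))) / T) ^ (r / q)) =
      l ^ (r / q) * (x ^ (r - q) * F ^ q * (1 + T ^ (-r))) := by
  have hp0 : 0 < p := by linarith
  have hq0 : 0 < q := by linarith
  have hr0 : 0 < r := by
    rw [hr, sub_pos, lt_div_iff₀ hp0]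
    linarith
  have hW : 0 < 1 + T ^ r := by positivity
  have hsplit : 1 + T ^ (-r) = (1 + T ^ r) * T ^ (-r) := by
    rw [add_mul, ← Real.rpow_add hT, add_neg_cancel, Real.rpow_zero, one_mul, add_comm]
  rw [hsplit]
  generalize 1 + T ^ r = W at hW
  obtain ⟨a, rfl⟩ : ∃ a, Real.exp a = F := ⟨_, Real.exp_log hF⟩
  obtain ⟨b, rfl⟩ : ∃ a, Real.exp a = x := ⟨_, Real.exp_log hx⟩
  obtain ⟨c, rfl⟩ : ∃ a, Real.exp a = T := ⟨_, Real.exp_log hT⟩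
  obtain ⟨d, rfl⟩ : ∃ a, Real.exp a = W := ⟨_, Real.exp_log hW⟩
  obtain ⟨e, rfl⟩ : ∃ a, Real.exp a = l := ⟨_, Real.exp_log hl⟩
  simp only [← Real.exp_mul, ← Real.exp_add, ← Real.exp_neg, ← Real.exp_sub]
  congr 1
  subst hr
  have : q - p ≠ 0 := by linarith
  field_simp
  ring

namespace IsRegularProfile

variable {f : ℝ → ℝ}

/-- Bliss's inequality for regular profiles. The density `x ^ (r - q) * F ^ q` is transported
monotonically onto the corresponding density of the extremal function; the derivative of
`F ^ (1 + q / p') * x ^ (-(q - r) / p') * T ^ (-r / p')`, where `T` is the transport map, is then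
estimated from below by the inequality between the weighted arithmetic and geometric means, and
from above by Hölder's inequality. All three are equalities for the extremal function, for which
`T` is the identity. -/
theorem bliss (hf : IsRegularProfile f) {p q : ℝ} (hp : 1 < p) (hpq : p < q) :
    (∫ x in Ioi (0 : ℝ), x ^ (q / p - 1 - q) * (∫ t in (0 : ℝ)..x, f t) ^ q) ^ (1 / q) ≤
      blissConst p q * (∫ x in Ioi 0, f x ^ p) ^ (1 / p) := by
  rw [blissConst]
  obtain ⟨r, hr⟩ : ∃ r, r = q / p - 1 := ⟨_, rfl⟩
  rw [← hr]
  have hp0 : 0 < p := by linarith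
  have hp1 : 0 < p - 1 := by linarith
  have hq0 : 0 < q := by linarith
  have hr0 : 0 < r := by
    rw [hr, sub_pos, lt_div_iff₀ hp0]
    linarith
  have hqc : q * (1 - 1 / p) = q - 1 - r := by
    rw [hr]
    field_simp
    ring
  have hqc0 : 0 < q * (1 - 1 / p) := by
    have : 1 / p < 1 := by rw [div_lt_one hp0]; exact hp
    exact mul_pos hq0 (by linarith)
  have hqr : 1 + r < q := by linarith
  have hIi := hf.integrableOn_primitive hr0.le hq0 (by linarith : r - q < -1)
  have hIpos := hf.integral_primitive_pos hr0.le hq0 (by linarith : r - q < -1)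
  set F : ℝ → ℝ := fun x => ∫ t in (0 : ℝ)..x, f t with hF
  set I := ∫ x in Ioi (0 : ℝ), x ^ (r - q) * F x ^ q with hI
  have hFpos : ∀ x, 0 < x → 0 < F x := fun x hx => hf.primitive_pos hx
  have hFm : Measurable F := hf.continuous_primitive.measurable
  have hE : 0 < blissMass q r := blissMass_pos hr0 (by linarith)
  -- The factor `l` gives the two densities the same total mass.
  set l := blissMass q r / (q - 1 - r) / I with hl
  have hl0 : 0 < l := div_pos (div_pos hE (by linarith)) hIpos
  set h : ℝ → ℝ := fun y => y ^ r * (1 + y ^ r) ^ (-(q / r)) with hh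
  have hhpos : ∀ y, 0 < y → 0 < h y := fun y hy => by
    simp only [hh]
    positivity
  obtain ⟨T, Tim, Tm, Td, Teq⟩ := exists_monotone_transport (h := h)
    (k := fun x => l * (x ^ (r - q) * F x ^ q))
    (fun y hy => by
      have hy : (0 : ℝ) < y := hy
      have h1 : 1 + y ^ r ≠ 0 := by positivity
      exact ((Real.continuousAt_rpow_const _ _ (Or.inl hy.ne')).mul
        ((continuousAt_const.add (Real.continuousAt_rpow_const _ _ (Or.inl hy.ne'))).rpow_const
          (Or.inl h1))).continuousWithinAt)
    (integrableOn_bliss hr0 hqr) hhpos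
    (fun x hx => by
      have hx : (0 : ℝ) < x := hx
      exact (continuousAt_const.mul ((Real.continuousAt_rpow_const _ _ (Or.inl hx.ne')).mul
        (hf.continuous_primitive.continuousAt.rpow_const
          (Or.inl (hFpos x hx).ne')))).continuousWithinAt)
    (hIi.const_mul l)
    (fun x hx => by
      have := hFpos x hx
      positivity)
    (by
      rw [integral_const_mul, integral_bliss hr0 hqr, ← hI, hl]
      field_simp)
  have Tpos : ∀ x, 0 < x → 0 < T x := fun x hx => by
    have : T x ∈ T '' Ioi 0 := mem_image_of_mem T hx
    rwa [Tim] at this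
  have Tmeas : AEMeasurable T (volume.restrict (Ioi 0)) :=
    aemeasurable_restrict_of_monotoneOn measurableSet_Ioi Tm.monotoneOn
  have T0 : ∀ x, 0 < x → T x ^ (-r) = T x ^ (0 : ℝ) * (1 + T x ^ r) ^ (-(q / r)) / h (T x) := by
    intro x hx
    have := Tpos x hx
    simp only [hh]
    rw [Real.rpow_zero, Real.rpow_neg this.le]
    field_simp
  -- The change of variables `y = T x` evaluates the integral of `x ^ (r - q) * F ^ q * T ^ (-r)`.
  have hψi : IntegrableOn (fun x => x ^ (r - q) * F x ^ q * T x ^ (-r)) (Ioi 0) := by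
    have h1 := integrableOn_rpow_mul_one_add_rpow_rpow (r := r) (m := 0) (d := q / r) hr0
      (by norm_num) (by rw [zero_add]; gcongr; linarith)
    rw [← Tim, integrableOn_image_iff_integrableOn_deriv_smul_of_monotoneOn measurableSet_Ioi
      (fun x hx => (Td x hx).hasDerivWithinAt) Tm.monotoneOn] at h1
    refine (Integrable.const_mul h1 l⁻¹).congr ?_
    filter_upwards [ae_restrict_mem measurableSet_Ioi] with x hx
    rw [T0 x hx, smul_eq_mul]
    field_simp
  have hψ : ∫ x in Ioi (0 : ℝ), x ^ (r - q) * F x ^ q * T x ^ (-r) = blissMass q r / l := by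
    rw [blissMass]
    nth_rewrite 2 [← Tim]
    rw [integral_image_eq_integral_deriv_smul_of_monotoneOn measurableSet_Ioi
      (fun x hx => (Td x hx).hasDerivWithinAt) Tm.monotoneOn, div_eq_inv_mul, ← integral_const_mul]
    refine setIntegral_congr_fun measurableSet_Ioi fun x hx => ?_
    rw [T0 x hx, smul_eq_mul]
    field_simp
  obtain ⟨hfi, hfle⟩ := hf.integral_mul_le hp
    (φ := fun x => x ^ (-((q - r) * (1 - 1 / p))) * F x ^ (q * (1 - 1 / p)) *
      T x ^ (-(r * (1 - 1 / p))))
    (ψ := fun x => x ^ (r - q) * F x ^ q * T x ^ (-r))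
    (fun x hx => by
      have := hFpos x hx
      have := Tpos x hx
      positivity)
    (((measurable_id.pow_const _).mul (hFm.pow_const _)).aemeasurable.mul
      (Tmeas.pow_const _)).aestronglyMeasurable hψi
    (fun x hx => by
      have h1 := hFpos x hx
      have h2 := Tpos x hx
      rw [Real.mul_rpow (by positivity) (by positivity),
        Real.mul_rpow (by positivity) (by positivity), ← Real.rpow_mul hx.le,
        ← Real.rpow_mul h1.le, ← Real.rpow_mul h2.le]
      congr 3
      · field_simp
        ring
      · field_simp
      · field_simp)
  have hlim : Tendsto (fun x => F x ^ (1 + q * (1 - 1 / p)) *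
      x ^ (-((q - r) * (1 - 1 / p))) * T x ^ (-(r * (1 - 1 / p)))) (𝓝[>] 0) (𝓝 0) := by
    obtain ⟨B, hB0, hB⟩ := hf.exists_primitive_le_mul
    obtain ⟨A, hA0, hA⟩ := hf.exists_mul_le_primitive
    set D := (l * A ^ q) ^ (1 / (r + 1)) with hD
    have hD0 : 0 < D := by positivity
    -- Near the origin the transport map is bounded below by a multiple of the identity.
    have hTD : ∀ x, 0 < x → x ≤ 1 → D * x ≤ T x := by
      intro x hx hx1
      have h1 : ∫ t in (0 : ℝ)..x, l * A ^ q * t ^ r ≤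
          ∫ t in (0 : ℝ)..x, l * (t ^ (r - q) * F t ^ q) := by
        refine intervalIntegral.integral_mono_on_of_le_Ioo hx.le
          ((intervalIntegral.intervalIntegrable_rpow' (by linarith)).const_mul _)
          (intervalIntegrable_zero_of_integrableOn_Ioi (hIi.const_mul l) hx.le) fun t ht => ?_
        have ht0 : 0 < t := ht.1
        rw [mul_assoc]
        refine mul_le_mul_of_nonneg_left ?_ hl0.le
        calc A ^ q * t ^ r = t ^ (r - q) * (A * t) ^ q := by
              rw [Real.mul_rpow hA0.le ht0.le, mul_left_comm, ← Real.rpow_add ht0, sub_add_cancel]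
          _ ≤ _ := by
              gcongr
              exact hA t ht0 (ht.2.le.trans hx1)
      have h2 : ∫ y in (0 : ℝ)..T x, h y ≤ ∫ y in (0 : ℝ)..T x, y ^ r := by
        refine intervalIntegral.integral_mono_on_of_le_Ioo (Tpos x hx).le
          (intervalIntegrable_zero_of_integrableOn_Ioi (integrableOn_bliss hr0 hqr) (Tpos x hx).le)
          (intervalIntegral.intervalIntegrable_rpow' (by linarith)) fun t ht => ?_
        have ht0 : 0 < t := ht.1
        refine mul_le_of_le_one_right (by positivity) ?_
        exact Real.rpow_le_one_of_one_le_of_nonpos (by linarith [Real.rpow_pos_of_pos ht0 r])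
          (by have := div_pos hq0 hr0; linarith)
      rw [intervalIntegral.integral_const_mul, ← Teq x hx] at h1
      have h3 := h1.trans h2
      rw [integral_rpow (Or.inl (by linarith)), integral_rpow (Or.inl (by linarith)),
        Real.zero_rpow (by linarith), sub_zero, sub_zero, ← mul_div_assoc,
        div_le_div_iff_of_pos_right (by linarith)] at h3
      refine (Real.rpow_le_rpow_iff (by positivity) (Tpos x hx).le (by linarith : 0 < r + 1)).1 ?_
      rwa [Real.mul_rpow hD0.le hx.le, hD, ← Real.rpow_mul (by positivity),
        one_div_mul_cancel (by linarith), Real.rpow_one]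
    have hlim' : Tendsto (fun x : ℝ => B ^ (1 + q * (1 - 1 / p)) * D ^ (-(r * (1 - 1 / p))) * x)
        (𝓝[>] 0) (𝓝 0) := by
      have : Tendsto (fun x : ℝ => B ^ (1 + q * (1 - 1 / p)) * D ^ (-(r * (1 - 1 / p))) * x)
        (𝓝 0) (𝓝 (B ^ (1 + q * (1 - 1 / p)) * D ^ (-(r * (1 - 1 / p))) * 0)) :=
        tendsto_id.const_mul _
      rw [mul_zero] at this
      exact this.mono_left nhdsWithin_le_nhds
    refine squeeze_zero' ?_ ?_ hlim'
    · filter_upwards [self_mem_nhdsWithin] with x (hx : (0 : ℝ) < x)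
      have := hFpos x hx
      have := Tpos x hx
      positivity
    · filter_upwards [Ioo_mem_nhdsGT (zero_lt_one' ℝ)] with x hx
      have hx0 := hx.1
      have h1 := hFpos x hx0
      have h2 := Tpos x hx0
      have hc : 0 < 1 - 1 / p := pos_of_mul_pos_right hqc0 hq0.le
      calc F x ^ (1 + q * (1 - 1 / p)) * x ^ (-((q - r) * (1 - 1 / p))) *
            T x ^ (-(r * (1 - 1 / p)))
          ≤ (B * x) ^ (1 + q * (1 - 1 / p)) * x ^ (-((q - r) * (1 - 1 / p))) *
            (D * x) ^ (-(r * (1 - 1 / p))) := by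
            have h3 : T x ^ (-(r * (1 - 1 / p))) ≤ (D * x) ^ (-(r * (1 - 1 / p))) :=
              Real.rpow_le_rpow_of_nonpos (by positivity) (hTD x hx0 hx.2.le)
                (by have := mul_pos hr0 hc; linarith)
            gcongr
            exact hB x hx0
        _ = B ^ (1 + q * (1 - 1 / p)) * D ^ (-(r * (1 - 1 / p))) *
            (x ^ (1 + q * (1 - 1 / p)) * x ^ (-((q - r) * (1 - 1 / p))) *
              x ^ (-(r * (1 - 1 / p)))) := by
            rw [Real.mul_rpow hB0.le hx0.le, Real.mul_rpow hD0.le hx0.le]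
            ring
        _ = _ := by
            rw [← Real.rpow_add hx0, ← Real.rpow_add hx0,
              show 1 + q * (1 - 1 / p) + -((q - r) * (1 - 1 / p)) + -(r * (1 - 1 / p)) = 1 by ring,
              Real.rpow_one]
  -- Integrate the derivative of `P = F ^ (1 + q c) * x ^ (-(q - r) c) * T ^ (-r c)`.
  have key := integral_Ioi_le_of_hasDerivAt
    (g := fun x => (1 + q * (1 - 1 / p)) * (f x * (x ^ (-((q - r) * (1 - 1 / p))) *
      F x ^ (q * (1 - 1 / p)) * T x ^ (-(r * (1 - 1 / p))))))
    (k := fun x => q * (1 - 1 / p) * l ^ (r / q) *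
      (x ^ (r - q) * F x ^ q + x ^ (r - q) * F x ^ q * T x ^ (-r)))
    (fun x hx => (((hf.hasDerivAt_primitive x).rpow_const (p := 1 + q * (1 - 1 / p))
      (Or.inl (hFpos x hx).ne')).mul
        (Real.hasDerivAt_rpow_const (p := -((q - r) * (1 - 1 / p))) (Or.inl hx.ne'))).mul
        ((Td x hx).rpow_const (p := -(r * (1 - 1 / p))) (Or.inl (Tpos x hx).ne')))
    (fun x hx => by
      have := hFpos x hx
      have := Tpos x hx
      simp only [Pi.mul_apply]
      positivity) hlim (hfi.const_mul _) ((hIi.add hψi).const_mul _)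
    (fun x hx => by
      have h1 := hFpos x hx
      have h2 := Tpos x hx
      have hθ : r / q < 1 := by rw [div_lt_one hq0]; linarith
      have hT' : 0 < l * (x ^ (r - q) * F x ^ q) / h (T x) := by
        have := hhpos _ h2
        positivity
      have hamgm := Real.geom_mean_le_arith_mean2_weighted (w₁ := 1 - r / q) (w₂ := r / q)
        (p₁ := x⁻¹) (p₂ := l * (x ^ (r - q) * F x ^ q) / h (T x) / T x) (by linarith)
        (by positivity) (by positivity) (by positivity) (by ring)
      have hid := bliss_rpow_identity hp hpq hr h1 hx h2 hl0
      change _ * (_ * (l * (x ^ (r - q) * F x ^ q) / h (T x) / T x) ^ (r / q)) = _ at hid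
      set W := F x ^ (1 + q * (1 - 1 / p)) * x ^ (-((q - r) * (1 - 1 / p))) *
        T x ^ (-(r * (1 - 1 / p))) with hW
      have hW0 : 0 < W := by positivity
      have hle := mul_le_mul_of_nonneg_left hamgm (mul_pos hqc0 hW0).le
      rw [mul_assoc, hid] at hle
      set T' := l * (x ^ (r - q) * F x ^ q) / h (T x) with hT'd
      have e1 : x ^ (-((q - r) * (1 - 1 / p)) - 1) = x ^ (-((q - r) * (1 - 1 / p))) * x⁻¹ := by
        rw [Real.rpow_sub hx, Real.rpow_one, div_eq_mul_inv]
      have e2 : T x ^ (-(r * (1 - 1 / p)) - 1) = T x ^ (-(r * (1 - 1 / p))) * (T x)⁻¹ := by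
        rw [Real.rpow_sub h2, Real.rpow_one, div_eq_mul_inv]
      rw [e1, e2, show 1 + q * (1 - 1 / p) - 1 = q * (1 - 1 / p) by ring]
      have e3 : q * (1 - 1 / p) * W * ((1 - r / q) * x⁻¹ + r / q * (T' / T x)) =
          (q - r) * (1 - 1 / p) * W * x⁻¹ + r * (1 - 1 / p) * W * T' * (T x)⁻¹ := by
        field_simp
      rw [e3] at hle
      rw [hW] at hle
      simp only [Pi.mul_apply]
      change (f x * _ * _ * _ + F x ^ _ * _) * _ + _ + _ ≤ _
      linarith)
  rw [integral_const_mul, integral_const_mul, integral_add hIi hψi, hψ, ← hI] at key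
  rw [hψ] at hfle
  set N := (∫ x in Ioi 0, f x ^ p) ^ (1 / p)
  -- In terms of `e = ∫ x ^ (r - q) * F ^ q * T ^ (-r)` both `l` and `I` are explicit, and the two
  -- estimates combine to the inequality with the sharp constant.
  obtain ⟨e, he⟩ : ∃ e, e = blissMass q r / l := ⟨_, rfl⟩
  have he0 : 0 < e := he ▸ div_pos hE hl0
  rw [← he] at key hfle
  have hle : l = blissMass q r / e := by rw [he]; field_simp
  have hIe : I = e / (q * (1 - 1 / p)) := by
    rw [he, hl, hqc]
    have : q - 1 - r ≠ 0 := by linarith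
    field_simp
  have k1 : l ^ (r / q) * e ≤ N * e ^ (1 - 1 / p) := by
    have h1 := key.trans (mul_le_mul_of_nonneg_left hfle (by linarith))
    refine le_of_mul_le_mul_left ?_ (by linarith : 0 < 1 + q * (1 - 1 / p))
    refine le_trans (le_of_eq ?_) h1
    rw [hIe]
    field_simp
  have k2 : blissMass q r ^ (1 / p - 1 / q) * e ^ (1 / q) ≤ N := by
    refine le_of_mul_le_mul_right (le_trans (le_of_eq ?_) k1)
      (Real.rpow_pos_of_pos he0 (1 - 1 / p))
    rw [hle, Real.div_rpow hE.le he0.le, show r / q = 1 / p - 1 / q by rw [hr]; field_simp,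
      mul_assoc, ← Real.rpow_add he0, div_mul_eq_mul_div, mul_div_assoc]
    congr 1
    rw [eq_div_iff (Real.rpow_pos_of_pos he0 _).ne', ← Real.rpow_add he0]
    conv_rhs => rw [← Real.rpow_one e]
    congr 1
    ring
  have k3 : e ^ (1 / q) ≤ blissMass q r ^ (1 / q - 1 / p) * N := by
    rw [show 1 / q - 1 / p = -(1 / p - 1 / q) by ring, Real.rpow_neg hE.le,
      ← div_eq_inv_mul, le_div_iff₀ (Real.rpow_pos_of_pos hE _), mul_comm]
    exact k2
  rw [hIe, div_eq_inv_mul, Real.mul_rpow (by positivity) he0.le, mul_assoc,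
    show p / (p - 1) / q = (q * (1 - 1 / p))⁻¹ by field_simp]
  gcongr

end IsRegularProfile

/-! ### Extension to measurable functions -/

/-- The approximants used to pass to general functions; the exponential makes them positive. -/
theorem isRegularProfile_abs_add_exp {φ : ℝ → ℝ} (hc : Continuous φ) (hs : HasCompactSupport φ)
    {δ : ℝ} (hδ : 0 < δ) : IsRegularProfile fun x => |φ x| + δ * Real.exp (-|x|) where
  continuous := by fun_prop
  pos x := by positivity
  bounded := by
    obtain ⟨B, hB⟩ := hs.exists_bound_of_continuous hc
    refine ⟨B + δ, fun x => add_le_add (hB x) (mul_le_of_le_one_right hδ.le ?_)⟩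
    exact Real.exp_le_one_iff.2 (by simp)
  integrableOn := by
    refine (hc.integrable_of_hasCompactSupport hs).abs.integrableOn.add (Integrable.const_mul ?_ δ)
    refine (integrableOn_exp_neg_Ioi 0).congr_fun (fun x hx => ?_) measurableSet_Ioi
    simp only [abs_of_pos (mem_Ioi.1 hx)]

namespace IsRegularProfile

variable {f : ℝ → ℝ}

theorem ofReal_primitive (hf : IsRegularProfile f) {t : ℝ} (ht : 0 < t) :
    ENNReal.ofReal (∫ s in (0 : ℝ)..t, f s) = ∫⁻ s in Ioo 0 t, ENNReal.ofReal (f s) := by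
  rw [intervalIntegral.integral_of_le ht.le, integral_Ioc_eq_integral_Ioo,
    ofReal_integral_eq_lintegral_ofReal (hf.integrableOn.mono_set Ioo_subset_Ioi_self)
      (Eventually.of_forall fun x => (hf.pos x).le)]

theorem ofReal_integral_rpow (hf : IsRegularProfile f) {p : ℝ} (hp : 1 ≤ p) :
    ENNReal.ofReal ((∫ x in Ioi 0, f x ^ p) ^ (1 / p)) =
      eLpNorm f (ENNReal.ofReal p) (volume.restrict (Ioi 0)) := by
  have hp0 : 0 < p := by linarith
  rw [eLpNorm_eq_lintegral_rpow_enorm_toReal (by simpa using hp0) ENNReal.ofReal_ne_top,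
    ENNReal.toReal_ofReal hp0.le,
    ← ENNReal.ofReal_rpow_of_nonneg (integral_nonneg fun x => Real.rpow_nonneg (hf.pos x).le _)
      (by positivity),
    ofReal_integral_eq_lintegral_ofReal (hf.integrableOn_rpow hp)
      (Eventually.of_forall fun x => Real.rpow_nonneg (hf.pos x).le _)]
  congr 2
  ext x
  rw [Real.enorm_of_nonneg (hf.pos x).le, ENNReal.ofReal_rpow_of_nonneg (hf.pos x).le hp0.le]

end IsRegularProfile

/-- A weighted Hardy-type inequality that holds for regular profiles holds for all measurable
functions: approximate in `L^p` and use Fatou's lemma. -/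
theorem lintegral_hardy_of_regular {p q r C : ℝ} (hp : 1 ≤ p) (hq : 0 < q) (hr : 0 ≤ r)
    (hrq : r - q < -1) (hC : 0 < C)
    (hreg : ∀ f : ℝ → ℝ, IsRegularProfile f →
      (∫ x in Ioi (0 : ℝ), x ^ (r - q) * (∫ t in (0 : ℝ)..x, f t) ^ q) ^ (1 / q) ≤
        C * (∫ x in Ioi 0, f x ^ p) ^ (1 / p))
    {f : ℝ → ℝ≥0∞} (hf : Measurable f) :
    (∫⁻ t in Ioi (0 : ℝ), (∫⁻ s in Ioo 0 t, f s) ^ q * ENNReal.ofReal (t ^ (r - q))) ^ (1 / q) ≤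
      ENNReal.ofReal C * (∫⁻ t in Ioi (0 : ℝ), f t ^ p) ^ (1 / p) := by
  have hp0 : 0 < p := by linarith
  have hC' : ENNReal.ofReal C ≠ 0 := by simpa using hC
  set μ : Measure ℝ := volume.restrict (Ioi 0) with hμ
  rcases eq_or_ne (∫⁻ t, f t ^ p ∂μ) ∞ with htop | hfin
  · rw [htop, ENNReal.top_rpow_of_pos (by positivity), ENNReal.mul_top hC']
    exact le_top
  have hflt : ∀ᵐ t ∂μ, f t < ∞ := by
    filter_upwards [ae_lt_top (hf.pow_const p) hfin] with t ht
    by_contra h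
    rw [not_lt_top_iff.1 h, ENNReal.top_rpow_of_pos hp0] at ht
    exact lt_irrefl _ ht
  set g : ℝ → ℝ := fun t => (f t).toReal with hg
  have hgm : Measurable g := hf.ennreal_toReal
  have hgf : ∀ᵐ t ∂μ, ‖g t‖ₑ = f t := by
    filter_upwards [hflt] with t ht
    rw [Real.enorm_of_nonneg ENNReal.toReal_nonneg, ENNReal.ofReal_toReal ht.ne]
  set P := ENNReal.ofReal p with hP
  have hP0 : P ≠ 0 := by simpa [hP] using hp0
  have hP1 : 1 ≤ P := by rw [hP, ← ENNReal.ofReal_one]; exact ENNReal.ofReal_le_ofReal hp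
  have hPt : P ≠ ∞ := ENNReal.ofReal_ne_top
  have hgA : eLpNorm g P μ = (∫⁻ t, f t ^ p ∂μ) ^ (1 / p) := by
    rw [eLpNorm_eq_lintegral_rpow_enorm_toReal hP0 hPt, hP, ENNReal.toReal_ofReal hp0.le]
    congr 1
    refine lintegral_congr_ae ?_
    filter_upwards [hgf] with t ht
    rw [ht]
  have hgL : MemLp g P μ := ⟨hgm.aestronglyMeasurable, by
    rw [hgA]
    exact ENNReal.rpow_lt_top_of_nonneg (by positivity) hfin⟩
  have hexp : eLpNorm (fun x : ℝ => Real.exp (-|x|)) P μ ≠ ∞ := by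
    have h0 := isRegularProfile_abs_add_exp (φ := 0) continuous_const HasCompactSupport.zero one_pos
    have := h0.ofReal_integral_rpow hp
    simp only [Pi.zero_apply, abs_zero, zero_add, one_mul] at this
    rw [← this]
    exact ENNReal.ofReal_ne_top
  set K := eLpNorm (fun x : ℝ => Real.exp (-|x|)) P μ with hK
  obtain ⟨δ, -, hδ0, hδ⟩ := exists_seq_strictAnti_tendsto (0 : ℝ)
  have hδE : Tendsto (fun n => ENNReal.ofReal (δ n)) atTop (𝓝 0) := by
    simpa using ENNReal.tendsto_ofReal hδ
  have hδ0' : ∀ n, ENNReal.ofReal (δ n) ≠ 0 := fun n => by simpa using hδ0 n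
  have happ := fun n => hgL.exists_hasCompactSupport_eLpNorm_sub_le hPt (hδ0' n)
  choose φ hφs hφle hφc hφL using happ
  set u : ℕ → ℝ → ℝ := fun n x => |φ n x| + δ n * Real.exp (-|x|) with hu
  have hureg : ∀ n, IsRegularProfile (u n) := fun n =>
    isRegularProfile_abs_add_exp (hφc n) (hφs n) (hδ0 n)
  -- The norm of the approximating profiles.
  have hunorm : ∀ n, eLpNorm (u n) P μ ≤
      eLpNorm g P μ + ENNReal.ofReal (δ n) * (1 + K) := by
    intro n
    have h1 : eLpNorm (u n) P μ ≤ eLpNorm (fun x => |φ n x|) P μ +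
        eLpNorm (fun x => δ n * Real.exp (-|x|)) P μ :=
      eLpNorm_add_le (hφc n).abs.aestronglyMeasurable
        (by fun_prop : Continuous fun x : ℝ => δ n * Real.exp (-|x|)).aestronglyMeasurable hP1
    have h2 : eLpNorm (fun x => |φ n x|) P μ ≤ eLpNorm g P μ + ENNReal.ofReal (δ n) := by
      have h3 : eLpNorm (fun x => |φ n x|) P μ = eLpNorm (g - (g - φ n)) P μ := by
        rw [sub_sub_cancel]
        exact eLpNorm_norm (φ n)
      rw [h3]
      exact (eLpNorm_sub_le hgm.aestronglyMeasurable
        (hgm.aestronglyMeasurable.sub (hφc n).aestronglyMeasurable) hP1).trans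
        (by gcongr; exact hφle n)
    have h4 : eLpNorm (fun x => δ n * Real.exp (-|x|)) P μ = ENNReal.ofReal (δ n) * K := by
      have := eLpNorm_const_smul (δ n) (fun x : ℝ => Real.exp (-|x|)) P μ
      rw [Real.enorm_of_nonneg (hδ0 n).le] at this
      exact this
    rw [h4] at h1
    calc _ ≤ _ := h1
      _ ≤ eLpNorm g P μ + ENNReal.ofReal (δ n) + ENNReal.ofReal (δ n) * K := by gcongr
      _ = _ := by ring
  -- The primitives of the approximating profiles are asymptotically at least that of `f`.
  have hprim : ∀ n t, 0 < t → ∫⁻ s in Ioo 0 t, f s ≤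
      ENNReal.ofReal (∫ s in (0 : ℝ)..t, u n s) +
        ENNReal.ofReal (δ n) * volume (Ioo 0 t) ^ (1 - 1 / p) := by
    intro n t ht
    have hsub : Ioo 0 t ⊆ Ioi (0 : ℝ) := Ioo_subset_Ioi_self
    rw [(hureg n).ofReal_primitive ht]
    have h1 : ∫⁻ s in Ioo 0 t, f s ≤
        ∫⁻ s in Ioo 0 t, (ENNReal.ofReal (u n s) + ‖(g - φ n) s‖ₑ) := by
      refine lintegral_mono_ae ?_
      filter_upwards [ae_mono (Measure.restrict_mono_set volume hsub) hgf] with s hs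
      rw [← hs]
      calc ‖g s‖ₑ = ‖φ n s + (g - φ n) s‖ₑ := by simp
        _ ≤ ‖φ n s‖ₑ + ‖(g - φ n) s‖ₑ := enorm_add_le _ _
        _ ≤ _ := by
          gcongr
          rw [← Real.enorm_abs, Real.enorm_of_nonneg (abs_nonneg _)]
          exact ENNReal.ofReal_le_ofReal
            (le_add_of_nonneg_right (mul_nonneg (hδ0 n).le (Real.exp_nonneg _)))
    have hm : Measurable fun s => ENNReal.ofReal (u n s) :=
      (hureg n).continuous.measurable.ennreal_ofReal
    rw [lintegral_add_left hm] at h1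
    refine h1.trans (add_le_add_right ?_ _)
    have h2 := eLpNorm_le_eLpNorm_mul_rpow_measure_univ hP1 (μ := volume.restrict (Ioo 0 t))
      (f := g - φ n) (hgm.aestronglyMeasurable.sub (hφc n).aestronglyMeasurable)
    rw [eLpNorm_one_eq_lintegral_enorm, Measure.restrict_apply_univ, hP,
      ENNReal.toReal_ofReal hp0.le, ENNReal.toReal_one, div_one] at h2
    refine h2.trans (mul_le_mul_left ?_ _)
    exact (eLpNorm_mono_measure _ (Measure.restrict_mono_set volume hsub)).trans (hφle n)
  have hbound : ∀ n, ∫⁻ t in Ioi (0 : ℝ), ENNReal.ofReal (∫ s in (0 : ℝ)..t, u n s) ^ q *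
      ENNReal.ofReal (t ^ (r - q)) ≤
      (ENNReal.ofReal C * (eLpNorm g P μ + ENNReal.ofReal (δ n) * (1 + K))) ^ q := by
    intro n
    have h1 := hreg (u n) (hureg n)
    have h2 : ∫⁻ t in Ioi (0 : ℝ), ENNReal.ofReal (∫ s in (0 : ℝ)..t, u n s) ^ q *
        ENNReal.ofReal (t ^ (r - q)) =
        ENNReal.ofReal (∫ x in Ioi (0 : ℝ), x ^ (r - q) * (∫ t in (0 : ℝ)..x, u n t) ^ q) := by
      rw [ofReal_integral_eq_lintegral_ofReal ((hureg n).integrableOn_primitive hr hq hrq)]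
      · refine setLIntegral_congr_fun measurableSet_Ioi fun t ht => ?_
        have ht : (0 : ℝ) < t := ht
        have := (hureg n).primitive_pos ht
        rw [ENNReal.ofReal_rpow_of_pos this, ← ENNReal.ofReal_mul (by positivity), mul_comm]
      · filter_upwards [ae_restrict_mem measurableSet_Ioi] with t ht
        have ht : (0 : ℝ) < t := ht
        have := (hureg n).primitive_pos ht
        simp only [Pi.zero_apply]
        positivity
    have hI := (hureg n).integral_primitive_pos hr hq hrq
    rw [h2, ← ENNReal.rpow_inv_le_iff hq, ← one_div, ENNReal.ofReal_rpow_of_pos hI]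
    refine (ENNReal.ofReal_le_ofReal h1).trans ?_
    rw [ENNReal.ofReal_mul hC.le, (hureg n).ofReal_integral_rpow hp]
    gcongr
    exact hunorm n
  have hlimR : Tendsto (fun n => (ENNReal.ofReal C * (eLpNorm g P μ + ENNReal.ofReal (δ n) *
      (1 + K))) ^ q) atTop (𝓝 ((ENNReal.ofReal C * eLpNorm g P μ) ^ q)) := by
    have h1 : Tendsto (fun n => ENNReal.ofReal (δ n) * (1 + K)) atTop (𝓝 (0 * (1 + K))) :=
      ENNReal.Tendsto.mul_const hδE (Or.inr (by simp [hexp]))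
    rw [zero_mul] at h1
    have h2 := (ENNReal.Tendsto.const_mul (tendsto_const_nhds.add h1)
      (Or.inr ENNReal.ofReal_ne_top) : Tendsto (fun n => ENNReal.ofReal C *
        (eLpNorm g P μ + ENNReal.ofReal (δ n) * (1 + K))) atTop
        (𝓝 (ENNReal.ofReal C * (eLpNorm g P μ + 0))))
    rw [add_zero] at h2
    exact h2.ennrpow_const q
  have hfat : ∫⁻ t in Ioi (0 : ℝ), (∫⁻ s in Ioo 0 t, f s) ^ q * ENNReal.ofReal (t ^ (r - q)) ≤
      liminf (fun n => ∫⁻ t in Ioi (0 : ℝ), ENNReal.ofReal (∫ s in (0 : ℝ)..t, u n s) ^ q *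
        ENNReal.ofReal (t ^ (r - q))) atTop := by
    refine le_trans (setLIntegral_mono' measurableSet_Ioi fun t ht => ?_)
      (lintegral_liminf_le fun n => ?_)
    · have ht : (0 : ℝ) < t := ht
      have hc : volume (Ioo 0 t) ^ (1 - 1 / p) ≠ ∞ := by
        refine ENNReal.rpow_ne_top_of_nonneg ?_ (by simp)
        rw [sub_nonneg, div_le_one hp0]
        exact hp
      have h1 : Tendsto (fun n => ENNReal.ofReal (δ n) * volume (Ioo 0 t) ^ (1 - 1 / p)) atTop
          (𝓝 0) := by
        have := ENNReal.Tendsto.mul_const hδE (Or.inr hc)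
        rwa [zero_mul] at this
      have h2 : Tendsto (fun n => (∫⁻ s in Ioo 0 t, f s) -
          ENNReal.ofReal (δ n) * volume (Ioo 0 t) ^ (1 - 1 / p)) atTop
          (𝓝 ((∫⁻ s in Ioo 0 t, f s) - 0)) :=
        ENNReal.Tendsto.sub tendsto_const_nhds h1 (Or.inr ENNReal.zero_ne_top)
      rw [tsub_zero] at h2
      have h3 := ENNReal.Tendsto.mul_const (h2.ennrpow_const q)
        (Or.inr ENNReal.ofReal_ne_top : _ ∨ ENNReal.ofReal (t ^ (r - q)) ≠ ∞)
      rw [← h3.liminf_eq]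
      refine liminf_le_liminf (Eventually.of_forall fun n => ?_)
      gcongr
      exact tsub_le_iff_right.2 (hprim n t ht)
    · exact ((((hureg n).continuous_primitive.measurable.ennreal_ofReal).pow_const q).mul
        (by fun_prop))
  rw [one_div q, ENNReal.rpow_inv_le_iff hq, ← hgA]
  refine hfat.trans ?_
  rw [← hlimR.liminf_eq]
  exact liminf_le_liminf (Eventually.of_forall hbound)

/-- The sharp one-dimensional Hardy inequality. The exponent `-p` of the weight is written as in
Bliss's inequality with `q = p`. -/
theorem lintegral_hardy {p : ℝ} (hp : 1 < p) {f : ℝ → ℝ≥0∞} (hf : Measurable f) :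
    (∫⁻ t in Ioi (0 : ℝ), (∫⁻ s in Ioo 0 t, f s) ^ p * ENNReal.ofReal (t ^ (p / p - 1 - p))) ^
        (1 / p) ≤
      ENNReal.ofReal (p / (p - 1)) * (∫⁻ t in Ioi (0 : ℝ), f t ^ p) ^ (1 / p) := by
  rw [div_self (by linarith), sub_self]
  exact lintegral_hardy_of_regular hp.le (by linarith) le_rfl (by linarith)
    (div_pos (by linarith) (by linarith)) (fun f hf => hf.hardy hp) hf

/-- Bliss's inequality, with the sharp constant. -/
theorem lintegral_bliss {p q : ℝ} (hp : 1 < p) (hpq : p < q) {f : ℝ → ℝ≥0∞} (hf : Measurable f) :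
    (∫⁻ t in Ioi (0 : ℝ), (∫⁻ s in Ioo 0 t, f s) ^ q * ENNReal.ofReal (t ^ (q / p - 1 - q))) ^
        (1 / q) ≤
      ENNReal.ofReal (blissConst p q) * (∫⁻ t in Ioi (0 : ℝ), f t ^ p) ^ (1 / p) := by
  have hp0 : 0 < p := by linarith
  have hr : 0 < q / p - 1 := by
    rw [sub_pos, lt_div_iff₀ hp0]
    linarith
  have hq : q / p < q := div_lt_self (by linarith) hp
  have hp1 : 0 < p - 1 := by linarith
  have hC : 0 < blissConst p q := by
    have := blissMass_pos (q := q) hr (by linarith)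
    have hq0 : 0 < q := by linarith
    rw [blissConst]
    positivity
  exact lintegral_hardy_of_regular hp.le (by linarith) hr.le (by linarith) hC
    (fun f hf => hf.bliss hp hpq) hf

/-! ### Reduction to the half-line -/

namespace HomogeneousGroup

namespace QuasiNorm

variable {N : ℕ} {G : HomogeneousGroup N}

theorem sphereArea_pos (ρ : QuasiNorm G) (hN : 0 < N) : 0 < ρ.sphereArea := by
  have : Nonempty (Fin N) := ⟨⟨0, hN⟩⟩
  have hne : Nonempty (Fin N → ℝ) := inferInstance
  rw [sphereArea]
  refine ENNReal.toReal_pos (fun h => ?_) (measure_ne_top _ _)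
  have h1 := ρ.lintegral_polar hN (f := fun _ => 1) measurable_const
  simp [h] at h1

theorem ofReal_sphereArea (ρ : QuasiNorm G) :
    ENNReal.ofReal ρ.sphereArea = ρ.surfaceMeasure ρ.sphere :=
  ENNReal.ofReal_toReal (measure_ne_top _ _)

theorem toFun_dil_of_mem_sphere (ρ : QuasiNorm G) {r : ℝ} (hr : 0 < r) {y : Fin N → ℝ}
    (hy : y ∈ ρ.sphere) : ρ.toFun (G.dil r y) = r := by
  rw [ρ.dil_eq r hr, show ρ.toFun y = 1 from hy, mul_one]

/-- The polar decomposition with the radius written as `t ^ k`. -/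
theorem lintegral_polar_rpow (ρ : QuasiNorm G) (hN : 0 < N) {k : ℝ} (hk : 0 < k)
    {f : (Fin N → ℝ) → ℝ≥0∞} (hf : Measurable f) :
    ∫⁻ x, f x = ∫⁻ t in Ioi (0 : ℝ), ENNReal.ofReal (k * t ^ (k * G.homDim - 1)) *
      ∫⁻ y in ρ.sphere, f (G.dil (t ^ k) y) ∂ρ.surfaceMeasure := by
  rw [ρ.lintegral_polar hN hf, lintegral_comp_rpow_mul_Ioi hk]
  refine setLIntegral_congr_fun measurableSet_Ioi fun t ht => ?_
  have ht : (0 : ℝ) < t := ht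
  rw [mul_comm (∫⁻ y in ρ.sphere, f (G.dil (t ^ k) y) ∂ρ.surfaceMeasure), ← _root_.mul_assoc,
    ← ENNReal.ofReal_mul (by positivity), ← Real.rpow_mul ht.le, _root_.mul_assoc,
    ← Real.rpow_add ht]
  congr 4
  ring

theorem lintegral_radial (ρ : QuasiNorm G) (hN : 0 < N) {k : ℝ} (hk : 0 < k)
    {h : ℝ → ℝ≥0∞} (hh : Measurable h) :
    ∫⁻ x, h (ρ.toFun x) = ENNReal.ofReal (ρ.sphereArea * k) *
      ∫⁻ t in Ioi (0 : ℝ), h (t ^ k) * ENNReal.ofReal (t ^ (k * G.homDim - 1)) := by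
  have hS := ρ.sphereArea_pos hN
  rw [ρ.lintegral_polar_rpow hN hk (f := fun x => h (ρ.toFun x)) (hh.comp ρ.measurable_toFun),
    ← lintegral_const_mul _ (by fun_prop)]
  refine setLIntegral_congr_fun measurableSet_Ioi fun t ht => ?_
  have ht : (0 : ℝ) < t := ht
  rw [setLIntegral_congr_fun (g := fun _ => h (t ^ k)) ρ.measurableSet_sphere fun y hy => by
    simp only [ρ.toFun_dil_of_mem_sphere (Real.rpow_pos_of_pos ht k) hy], setLIntegral_const,
    ← ρ.ofReal_sphereArea, ENNReal.ofReal_mul hk.le, ENNReal.ofReal_mul hS.le]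
  ring

/-- The density, in the variable `t = |x| ^ (1 / k)`, of the measure `w dx` on the group. -/
noncomputable def radialDensity (ρ : QuasiNorm G) (k : ℝ) (w : (Fin N → ℝ) → ℝ≥0∞) (t : ℝ) :
    ℝ≥0∞ :=
  ENNReal.ofReal (k * t ^ (k * G.homDim - 1)) *
    ∫⁻ y in ρ.sphere, w (G.dil (t ^ k) y) ∂ρ.surfaceMeasure

theorem measurable_radialDensity (ρ : QuasiNorm G) (k : ℝ) {w : (Fin N → ℝ) → ℝ≥0∞}
    (hw : Measurable w) : Measurable (ρ.radialDensity k w) := by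
  refine Measurable.mul (by fun_prop) ?_
  exact Measurable.lintegral_prod_right' (f := fun z : ℝ × (Fin N → ℝ) => w (G.dil (z.1 ^ k) z.2))
    (hw.comp (G.measurable_dil.comp ((measurable_fst.pow_const k).prodMk measurable_snd)))

theorem lintegral_ball (ρ : QuasiNorm G) (hN : 0 < N) {k : ℝ} (hk : 0 < k)
    {w : (Fin N → ℝ) → ℝ≥0∞} (hw : Measurable w) {τ : ℝ} (hτ : 0 < τ) :
    ∫⁻ y in ρ.ball 0 (τ ^ k), w y = ∫⁻ t in Ioo 0 τ, ρ.radialDensity k w t := by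
  rw [← lintegral_indicator (ρ.measurableSet_ball_zero _),
    ρ.lintegral_polar_rpow hN hk (hw.indicator (ρ.measurableSet_ball_zero _)),
    ← Ioi_inter_Iio, ← Measure.restrict_restrict_of_subset (s := Ioi 0 ∩ Iio τ) (t := Ioi (0 : ℝ))
      inter_subset_left, Ioi_inter_Iio, ← lintegral_indicator measurableSet_Ioo]
  refine setLIntegral_congr_fun measurableSet_Ioi fun t ht => ?_
  have ht : (0 : ℝ) < t := ht
  by_cases hlt : t < τ
  · rw [indicator_of_mem (show t ∈ Ioo 0 τ from ⟨ht, hlt⟩), radialDensity]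
    congr 1
    refine setLIntegral_congr_fun ρ.measurableSet_sphere fun y hy => ?_
    rw [indicator_of_mem]
    rw [ρ.mem_ball_zero, ρ.toFun_dil_of_mem_sphere (Real.rpow_pos_of_pos ht k) hy]
    exact Real.rpow_lt_rpow ht.le hlt hk
  · rw [indicator_of_notMem fun h : t ∈ Ioo 0 τ => hlt h.2,
      setLIntegral_congr_fun (g := fun _ => 0) ρ.measurableSet_sphere fun y hy => ?_]
    · simp
    · simp only
      rw [indicator_of_notMem]
      rw [ρ.mem_ball_zero, ρ.toFun_dil_of_mem_sphere (Real.rpow_pos_of_pos ht k) hy, not_lt]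
      exact Real.rpow_le_rpow hτ.le (not_lt.1 hlt) hk.le

/-- The left-hand side of the Hardy inequality depends on `w` only through its radial density. -/
theorem lintegral_ball_rpow_mul (ρ : QuasiNorm G) (hN : 0 < N) {k : ℝ} (hk : 0 < k)
    {w : (Fin N → ℝ) → ℝ≥0∞} (hw : Measurable w) (q β : ℝ) :
    ∫⁻ x, (∫⁻ y in ρ.ball 0 (ρ.toFun x), w y) ^ q * ENNReal.ofReal (ρ.toFun x ^ β) =
      ENNReal.ofReal (ρ.sphereArea * k) * ∫⁻ t in Ioi (0 : ℝ),
        (∫⁻ s in Ioo 0 t, ρ.radialDensity k w s) ^ q *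
          ENNReal.ofReal (t ^ (k * (β + G.homDim) - 1)) := by
  have hmono : Monotone fun R : ℝ => ∫⁻ y in ρ.ball 0 R, w y := fun R R' h =>
    lintegral_mono_set fun x hx => ρ.mem_ball_zero.2 ((ρ.mem_ball_zero.1 hx).trans_le h)
  rw [ρ.lintegral_radial hN hk
    (h := fun R => (∫⁻ y in ρ.ball 0 R, w y) ^ q * ENNReal.ofReal (R ^ β))
    ((hmono.measurable.pow_const q).mul (by fun_prop))]
  congr 1
  refine setLIntegral_congr_fun measurableSet_Ioi fun t ht => ?_
  have ht : (0 : ℝ) < t := ht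
  rw [ρ.lintegral_ball hN hk hw ht, _root_.mul_assoc, ← ENNReal.ofReal_mul (by positivity),
    ← Real.rpow_mul ht.le, ← Real.rpow_add ht]
  congr 3
  ring

/-- Hölder's inequality on the sphere: for the exponent `k = (p - 1) / (Q (p - 1) - α)` the
weighted `L^p` norm on the group controls the unweighted one of the radial density. -/
theorem lintegral_radialDensity_rpow_le (ρ : QuasiNorm G) (hN : 0 < N) {k p α : ℝ} (hk : 0 < k)
    (hp : 1 < p) (hkα : k * (G.homDim * (p - 1) - α) = p - 1)
    {w : (Fin N → ℝ) → ℝ≥0∞} (hw : Measurable w) :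
    ∫⁻ t in Ioi (0 : ℝ), ρ.radialDensity k w t ^ p ≤
      ENNReal.ofReal ((ρ.sphereArea * k) ^ (p - 1)) *
        ∫⁻ x, w x ^ p * ENNReal.ofReal (ρ.toFun x ^ α) := by
  have hS := ρ.sphereArea_pos hN
  have hp0 : 0 < p := by linarith
  have hp1 : 0 < p - 1 := by linarith
  rw [ρ.lintegral_polar_rpow hN hk (f := fun x => w x ^ p * ENNReal.ofReal (ρ.toFun x ^ α))
    ((hw.pow_const p).mul
    ((ρ.measurable_toFun.pow_const α).ennreal_ofReal)), ← lintegral_const_mul]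
  · refine setLIntegral_mono' measurableSet_Ioi fun t ht => ?_
    have ht : (0 : ℝ) < t := ht
    have htk : 0 < t ^ k := Real.rpow_pos_of_pos ht k
    have hwm : Measurable fun y => w (G.dil (t ^ k) y) :=
      hw.comp (G.measurable_dil.comp measurable_prodMk_left)
    have h1 : (∫⁻ y in ρ.sphere, w (G.dil (t ^ k) y) ∂ρ.surfaceMeasure) ^ p ≤
        ENNReal.ofReal (ρ.sphereArea ^ (p - 1)) *
          ∫⁻ y in ρ.sphere, w (G.dil (t ^ k) y) ^ p ∂ρ.surfaceMeasure := by
      have h := ENNReal.lintegral_mul_le_Lp_mul_Lq (ρ.surfaceMeasure.restrict ρ.sphere)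
        (Real.HolderConjugate.conjExponent hp) hwm.aemeasurable
        (aemeasurable_const (b := (1 : ℝ≥0∞)))
      simp only [Pi.mul_apply, mul_one, ENNReal.one_rpow, lintegral_one,
        Measure.restrict_apply_univ] at h
      rw [← ρ.ofReal_sphereArea] at h
      refine (ENNReal.rpow_le_rpow h hp0.le).trans (le_of_eq ?_)
      rw [ENNReal.mul_rpow_of_nonneg _ _ hp0.le, ← ENNReal.rpow_mul, ← ENNReal.rpow_mul,
        one_div_mul_cancel hp0.ne', ENNReal.rpow_one, mul_comm,
        show 1 / p.conjExponent * p = p - 1 by rw [Real.conjExponent]; field_simp,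
        ENNReal.ofReal_rpow_of_pos hS]
    have h2 : ∫⁻ y in ρ.sphere, w (G.dil (t ^ k) y) ^ p *
        ENNReal.ofReal (ρ.toFun (G.dil (t ^ k) y) ^ α) ∂ρ.surfaceMeasure =
        ENNReal.ofReal (t ^ (k * α)) *
          ∫⁻ y in ρ.sphere, w (G.dil (t ^ k) y) ^ p ∂ρ.surfaceMeasure := by
      rw [← lintegral_const_mul _ (hwm.pow_const p)]
      refine setLIntegral_congr_fun ρ.measurableSet_sphere fun y hy => ?_
      rw [ρ.toFun_dil_of_mem_sphere htk hy, ← Real.rpow_mul ht.le, mul_comm]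
    rw [radialDensity, ENNReal.mul_rpow_of_nonneg _ _ hp0.le]
    rw [h2]
    refine (mul_le_mul_right h1 _).trans (le_of_eq ?_)
    rw [ENNReal.ofReal_rpow_of_pos (by positivity), ← _root_.mul_assoc,
      ← _root_.mul_assoc, ← _root_.mul_assoc,
      ← ENNReal.ofReal_mul (by positivity), ← ENNReal.ofReal_mul (by positivity),
      ← ENNReal.ofReal_mul (by positivity)]
    congr 2
    rw [Real.mul_rpow hk.le (by positivity), Real.mul_rpow hS.le hk.le, ← Real.rpow_mul ht.le,
      show (k * G.homDim - 1) * p = (k * G.homDim - 1) + k * α by linear_combination hkα,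
      Real.rpow_add ht, show p = p - 1 + 1 by ring, Real.rpow_add_one hk.ne']
    ring_nf
  · exact ρ.measurable_radialDensity k ((hw.pow_const p).mul
      ((ρ.measurable_toFun.pow_const α).ennreal_ofReal))

/-- A one-dimensional inequality of Bliss type with constant `B` implies the Hardy inequality on
the group. -/
theorem hardyInequality_of_lintegral_hardy (ρ : QuasiNorm G) (hN : 0 < N) (𝕜 : Type*) [RCLike 𝕜]
    {k p q α β B : ℝ} (hk : 0 < k) (hp : 1 < p) (hq : 0 < q)
    (hkα : k * (G.homDim * (p - 1) - α) = p - 1) (hkβ : k * (β + G.homDim) = q / p - q)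
    (hB : ∀ f : ℝ → ℝ≥0∞, Measurable f →
      (∫⁻ t in Ioi (0 : ℝ), (∫⁻ s in Ioo 0 t, f s) ^ q * ENNReal.ofReal (t ^ (q / p - 1 - q))) ^
        (1 / q) ≤ ENNReal.ofReal B * (∫⁻ t in Ioi (0 : ℝ), f t ^ p) ^ (1 / p)) :
    ρ.HardyInequality 𝕜 p q α β ((ρ.sphereArea * k) ^ (1 + 1 / q - 1 / p) * B) := by
  intro u hu
  have hS := ρ.sphereArea_pos hN
  have hSk : 0 < ρ.sphereArea * k := mul_pos hS hk
  have hp0 : 0 < p := by linarith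
  have hw : Measurable fun y => ‖u y‖ₑ := hu.enorm
  set X := (∫⁻ x, ‖u x‖ₑ ^ p * ENNReal.ofReal (ρ.toFun x ^ α)) ^ (1 / p) with hX
  have h1 : ∫⁻ x, ‖∫ y in ρ.ball 0 (ρ.toFun x), u y‖ₑ ^ q * ENNReal.ofReal (ρ.toFun x ^ β) ≤
      ∫⁻ x, (∫⁻ y in ρ.ball 0 (ρ.toFun x), ‖u y‖ₑ) ^ q * ENNReal.ofReal (ρ.toFun x ^ β) := by
    refine lintegral_mono fun x => ?_
    gcongr
    exact enorm_integral_le_lintegral_enorm _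
  rw [ρ.lintegral_ball_rpow_mul hN hk hw q β,
    show k * (β + G.homDim) - 1 = q / p - 1 - q by rw [hkβ]; ring] at h1
  have h2 := (hB _ (ρ.measurable_radialDensity k hw)).trans (mul_le_mul_right
    (ENNReal.rpow_le_rpow (ρ.lintegral_radialDensity_rpow_le hN hk hp hkα hw)
      (by positivity : 0 ≤ 1 / p)) _)
  refine (ENNReal.rpow_le_rpow h1 (by positivity : 0 ≤ 1 / q)).trans ?_
  rw [ENNReal.mul_rpow_of_nonneg _ _ (by positivity : 0 ≤ 1 / q)]
  refine (mul_le_mul_right h2 _).trans (le_of_eq ?_)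
  rw [ENNReal.mul_rpow_of_nonneg _ _ (by positivity : 0 ≤ 1 / p), ← hX,
    ENNReal.ofReal_mul (p := (_ : ℝ) ^ (_ : ℝ)) (by positivity), ENNReal.ofReal_rpow_of_pos hSk,
    ENNReal.ofReal_rpow_of_pos (by positivity), ← Real.rpow_mul hSk.le,
    show 1 + 1 / q - 1 / p = 1 / q + (p - 1) * (1 / p) by field_simp; ring, Real.rpow_add hSk,
    ENNReal.ofReal_mul (by positivity)]
  ring

theorem integrableOn_ball (ρ : QuasiNorm G) (hN : 0 < N) {𝕜 : Type*} [RCLike 𝕜]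
    {p α : ℝ} (hp : 1 < p) (hα : α < G.homDim * (p - 1)) {u : (Fin N → ℝ) → 𝕜}
    (hu : Measurable u)
    (hfin : ∫⁻ x, ‖u x‖ₑ ^ p * ENNReal.ofReal (ρ.toFun x ^ α) < ∞) (R : ℝ) :
    IntegrableOn u (ρ.ball 0 R) := by
  rcases le_or_gt R 0 with hR | hR
  · have : ρ.ball 0 R = ∅ := by
      ext x
      simp only [ρ.mem_ball_zero, mem_empty_iff_false, iff_false, not_lt]
      exact hR.trans (ρ.nonneg x)
    rw [this]
    exact integrableOn_empty
  have hα' : 0 < G.homDim * (p - 1) - α := by linarith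
  have hp1 : 0 < p - 1 := by linarith
  obtain ⟨k, hk⟩ : ∃ k, k = (p - 1) / (G.homDim * (p - 1) - α) := ⟨_, rfl⟩
  have hk0 : 0 < k := hk ▸ div_pos hp1 hα'
  have hkα : k * (G.homDim * (p - 1) - α) = p - 1 := by
    rw [hk, div_mul_cancel₀ _ hα'.ne']
  refine ⟨hu.aestronglyMeasurable, ?_⟩
  rw [hasFiniteIntegral_iff_enorm]
  have hτ : 0 < R ^ k⁻¹ := Real.rpow_pos_of_pos hR _
  rw [← Real.rpow_inv_rpow hR.le hk0.ne', ρ.lintegral_ball hN hk0 hu.enorm hτ]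
  -- On a bounded interval `L^p` is contained in `L^1`.
  have hle : ∀ a : ℝ≥0∞, a ≤ 1 + a ^ p := fun a => by
    rcases le_total a 1 with h | h
    · exact h.trans le_self_add
    · calc a = a ^ (1 : ℝ) := (ENNReal.rpow_one a).symm
        _ ≤ a ^ p := ENNReal.rpow_le_rpow_of_exponent_le h hp.le
        _ ≤ _ := le_add_self
  refine (lintegral_mono fun t => hle _).trans_lt ?_
  rw [lintegral_add_left measurable_const]
  refine ENNReal.add_lt_top.2 ⟨by simp, ?_⟩
  refine (lintegral_mono_set Ioo_subset_Ioi_self).trans_lt ?_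
  refine (ρ.lintegral_radialDensity_rpow_le hN hk0 hp hkα hu.enorm).trans_lt ?_
  exact ENNReal.mul_lt_top ENNReal.ofReal_lt_top hfin

/-- The Hardy inequality on the group, tested on radial functions. The function `g` is the radial
density in the variable `t = |x| ^ (1 / k)`. -/
theorem HardyInequality.radial {ρ : QuasiNorm G} (hN : 0 < N) {𝕜 : Type*} [RCLike 𝕜]
    {p q α β C : ℝ} (h : ρ.HardyInequality 𝕜 p q α β C) (hp : 0 < p) (hq : 0 < q)
    {k : ℝ} (hk : 0 < k) {g : ℝ → ℝ} (hg : Measurable g) (hg0 : ∀ t, 0 ≤ g t)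
    (hgi : ∀ t, 0 < t → ∫⁻ s in Ioo 0 t, ENNReal.ofReal (g s) ≠ ∞) :
    (ENNReal.ofReal ((ρ.sphereArea * k) ^ (q + 1)) * ∫⁻ t in Ioi (0 : ℝ),
        (∫⁻ s in Ioo 0 t, ENNReal.ofReal (g s)) ^ q *
          ENNReal.ofReal (t ^ (k * (β + G.homDim) - 1))) ^ (1 / q) ≤
      ENNReal.ofReal C * (ENNReal.ofReal (ρ.sphereArea * k) * ∫⁻ t in Ioi (0 : ℝ),
        ENNReal.ofReal (g t) ^ p *
          ENNReal.ofReal (t ^ (k * (G.homDim + α - G.homDim * p) + p - 1))) ^ (1 / p) := by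
  have hS := ρ.sphereArea_pos hN
  have hSk : 0 < ρ.sphereArea * k := mul_pos hS hk
  -- The profile `ψ(|x|)` on the group whose radial density is proportional to `g`.
  set ψ : ℝ → ℝ := fun R => g (R ^ k⁻¹) * R ^ (k⁻¹ - G.homDim) with hψ
  have hψm : Measurable ψ := (hg.comp (measurable_id.pow_const _)).mul (measurable_id.pow_const _)
  have hψ0 : ∀ x, 0 ≤ ψ (ρ.toFun x) := fun x =>
    mul_nonneg (hg0 _) (Real.rpow_nonneg (ρ.nonneg x) _)
  have hψt : ∀ t, 0 < t → ψ (t ^ k) = g t * t ^ (1 - k * G.homDim) := by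
    intro t ht
    simp only [hψ]
    rw [Real.rpow_rpow_inv ht.le hk.ne', ← Real.rpow_mul ht.le]
    congr 2
    field_simp
  have hum : Measurable fun x => ((ψ (ρ.toFun x) : ℝ) : 𝕜) :=
    RCLike.measurable_ofReal.comp (hψm.comp ρ.measurable_toFun)
  have hen : ∀ x, ‖((ψ (ρ.toFun x) : ℝ) : 𝕜)‖ₑ = ENNReal.ofReal (ψ (ρ.toFun x)) := fun x => by
    rw [← ofReal_norm, RCLike.norm_ofReal, abs_of_nonneg (hψ0 x)]
  have hdens : ∀ t, 0 < t → ρ.radialDensity k (fun x => ENNReal.ofReal (ψ (ρ.toFun x))) t =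
      ENNReal.ofReal (ρ.sphereArea * k) * ENNReal.ofReal (g t) := by
    intro t ht
    rw [radialDensity, setLIntegral_congr_fun (g := fun _ => ENNReal.ofReal (ψ (t ^ k)))
      ρ.measurableSet_sphere fun y hy => by
        simp only [ρ.toFun_dil_of_mem_sphere (Real.rpow_pos_of_pos ht k) hy], setLIntegral_const,
      ← ρ.ofReal_sphereArea, hψt t ht, ← ENNReal.ofReal_mul (mul_nonneg (hg0 t) (by positivity)),
      ← ENNReal.ofReal_mul (by positivity), ← ENNReal.ofReal_mul hSk.le]
    congr 1
    calc _ = ρ.sphereArea * k * g t * (t ^ (k * G.homDim - 1) * t ^ (1 - k * G.homDim)) := by ring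
      _ = _ := by rw [← Real.rpow_add ht]; simp
  have hwm : Measurable fun x => ENNReal.ofReal (ψ (ρ.toFun x)) :=
    (hψm.comp ρ.measurable_toFun).ennreal_ofReal
  have hprim : ∀ t, 0 < t → ∫⁻ s in Ioo 0 t,
      ρ.radialDensity k (fun x => ENNReal.ofReal (ψ (ρ.toFun x))) s =
      ENNReal.ofReal (ρ.sphereArea * k) * ∫⁻ s in Ioo 0 t, ENNReal.ofReal (g s) := by
    intro t ht
    rw [← lintegral_const_mul _ hg.ennreal_ofReal]
    exact setLIntegral_congr_fun measurableSet_Ioo fun s hs => hdens s hs.1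
  have hball : ∀ R, ‖∫ y in ρ.ball 0 R, ((ψ (ρ.toFun y) : ℝ) : 𝕜)‖ₑ =
      ∫⁻ y in ρ.ball 0 R, ENNReal.ofReal (ψ (ρ.toFun y)) := by
    intro R
    have hfin : ∫⁻ y in ρ.ball 0 R, ENNReal.ofReal (ψ (ρ.toFun y)) ≠ ∞ := by
      rcases le_or_gt R 0 with hR | hR
      · have : ρ.ball 0 R = ∅ := by
          ext x
          simp only [ρ.mem_ball_zero, mem_empty_iff_false, iff_false, not_lt]
          exact hR.trans (ρ.nonneg x)
        simp [this]
      · have hτ : 0 < R ^ k⁻¹ := Real.rpow_pos_of_pos hR _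
        rw [← Real.rpow_inv_rpow hR.le hk.ne', ρ.lintegral_ball hN hk hwm hτ, hprim _ hτ]
        exact ENNReal.mul_ne_top ENNReal.ofReal_ne_top (hgi _ hτ)
    rw [integral_ofReal, ← ofReal_norm, RCLike.norm_ofReal,
      abs_of_nonneg (integral_nonneg fun y => hψ0 y), ofReal_integral_eq_lintegral_ofReal
      (f := fun y => ψ (ρ.toFun y)) ((lintegral_ofReal_ne_top_iff_integrable
        (hψm.comp ρ.measurable_toFun).aestronglyMeasurable (Eventually.of_forall hψ0)).1 hfin)
      (Eventually.of_forall hψ0)]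
  have key := h _ hum
  simp only [hball, hen] at key
  rw [ρ.lintegral_ball_rpow_mul hN hk hwm q β, ρ.lintegral_radial hN hk
    (h := fun R => ENNReal.ofReal (ψ R) ^ p * ENNReal.ofReal (R ^ α))
    ((hψm.ennreal_ofReal.pow_const p).mul (by fun_prop))] at key
  refine le_trans (le_of_eq ?_) (key.trans (le_of_eq ?_))
  · congr 1
    rw [Real.rpow_add hSk, Real.rpow_one, mul_comm (_ ^ q), ENNReal.ofReal_mul hSk.le,
      _root_.mul_assoc]
    congr 1
    rw [← lintegral_const_mul' _ _ ENNReal.ofReal_ne_top]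
    refine setLIntegral_congr_fun measurableSet_Ioi fun t ht => ?_
    rw [hprim t ht, ENNReal.mul_rpow_of_nonneg _ _ hq.le, ENNReal.ofReal_rpow_of_pos hSk,
      _root_.mul_assoc]
  · congr 3
    refine setLIntegral_congr_fun measurableSet_Ioi fun t ht => ?_
    have ht : (0 : ℝ) < t := ht
    rw [hψt t ht, ENNReal.ofReal_mul (hg0 t), ENNReal.mul_rpow_of_nonneg _ _ hp.le,
      ENNReal.ofReal_rpow_of_pos (Real.rpow_pos_of_pos ht (1 - k * G.homDim)),
      _root_.mul_assoc, _root_.mul_assoc, ← ENNReal.ofReal_mul (by positivity),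
      ← ENNReal.ofReal_mul (by positivity),
      ← Real.rpow_mul ht.le, ← Real.rpow_mul ht.le, ← Real.rpow_add ht, ← Real.rpow_add ht]
    congr 3
    ring

end QuasiNorm

end HomogeneousGroup

/-! ### Radial test functions -/

theorem lintegral_Ioo_rpow {a τ : ℝ} (ha : -1 < a) (hτ : 0 < τ) :
    ∫⁻ s in Ioo 0 τ, ENNReal.ofReal (s ^ a) = ENNReal.ofReal (τ ^ (a + 1) / (a + 1)) := by
  have hi : IntegrableOn (fun s : ℝ => s ^ a) (Ioo 0 τ) :=
    ((intervalIntegrable_iff_integrableOn_Ioc_of_le hτ.le).1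
      (intervalIntegral.intervalIntegrable_rpow' ha)).mono_set Ioo_subset_Ioc_self
  rw [← ofReal_integral_eq_lintegral_ofReal hi, ← integral_Ioc_eq_integral_Ioo,
    ← intervalIntegral.integral_of_le hτ.le, integral_rpow (Or.inl ha),
    Real.zero_rpow (by linarith), sub_zero]
  filter_upwards [ae_restrict_mem measurableSet_Ioo] with s hs
  exact Real.rpow_nonneg hs.1.le _

theorem lintegral_Ioo_bliss_extremal {r t : ℝ} (hr : 0 < r) (ht : 0 < t) :
    ∫⁻ s in Ioo 0 t, ENNReal.ofReal ((1 + |s| ^ r) ^ (-(1 / r + 1))) =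
      ENNReal.ofReal (t * (1 + t ^ r) ^ (-(1 / r))) := by
  have hcp : Continuous fun s : ℝ => 1 + |s| ^ r :=
    continuous_const.add (continuous_abs.rpow_const fun _ => Or.inr hr.le)
  have hpos : ∀ s : ℝ, 0 < 1 + |s| ^ r := fun s => by positivity
  have hc : Continuous fun s : ℝ => (1 + |s| ^ r) ^ (-(1 / r + 1)) :=
    hcp.rpow_const fun s => Or.inl (hpos s).ne'
  have hF : ∫ s in (0 : ℝ)..t, (1 + |s| ^ r) ^ (-(1 / r + 1)) =
      t * (1 + |t| ^ r) ^ (-(1 / r)) - 0 * (1 + |(0 : ℝ)| ^ r) ^ (-(1 / r)) := by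
    refine intervalIntegral.integral_eq_sub_of_hasDerivAt_of_le ht.le
      (f := fun s => s * (1 + |s| ^ r) ^ (-(1 / r)))
      (continuous_id.mul (hcp.rpow_const fun s => Or.inl (hpos s).ne')).continuousOn
      (fun s hs => ?_) (hc.intervalIntegrable _ _)
    have hs0 : 0 < s := hs.1
    have h1 : 0 < 1 + s ^ r := by positivity
    have hd : HasDerivAt (fun s : ℝ => s * (1 + s ^ r) ^ (-(1 / r)))
        (1 * (1 + s ^ r) ^ (-(1 / r)) +
          s * (r * s ^ (r - 1) * (-(1 / r)) * (1 + s ^ r) ^ (-(1 / r) - 1))) s :=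
      (hasDerivAt_id s).mul (((Real.hasDerivAt_rpow_const (Or.inl hs0.ne')).const_add 1).rpow_const
        (Or.inl h1.ne'))
    have heq : (fun s : ℝ => s * (1 + |s| ^ r) ^ (-(1 / r))) =ᶠ[𝓝 s]
        fun s : ℝ => s * (1 + s ^ r) ^ (-(1 / r)) := by
      filter_upwards [Ioi_mem_nhds hs0] with x hx
      rw [abs_of_pos hx]
    refine (hd.congr_of_eventuallyEq heq).congr_deriv ?_
    rw [abs_of_pos hs0, show -(1 / r + 1) = -(1 / r) - 1 by ring, Real.rpow_sub_one h1.ne',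
      Real.rpow_sub_one hs0.ne']
    field_simp
    ring
  rw [zero_mul, sub_zero, abs_of_pos ht] at hF
  rw [← hF, intervalIntegral.integral_of_le ht.le, integral_Ioc_eq_integral_Ioo,
    ofReal_integral_eq_lintegral_ofReal]
  · exact ((intervalIntegrable_iff_integrableOn_Ioc_of_le ht.le).1
      (hc.intervalIntegrable 0 t)).mono_set Ioo_subset_Ioc_self
  · exact Eventually.of_forall fun s => Real.rpow_nonneg (hpos s).le _

/-- If one power is bounded by a multiple of another on all of `(0, ∞)`, the exponents agree. -/
theorem rpow_exponent_eq_of_le {a b c d : ℝ} (hc : 0 < c)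
    (h : ∀ l : ℝ, 0 < l → c * l ^ a ≤ d * l ^ b) : a = b := by
  by_contra hab
  have hab' : a - b ≠ 0 := sub_ne_zero.2 hab
  have hd : 0 < d := by
    have := h 1 one_pos
    simp only [Real.one_rpow, mul_one] at this
    linarith
  have hl : 0 < (d / c + 1) ^ (1 / (a - b)) := by positivity
  have h1 := h _ hl
  have h2 : ((d / c + 1) ^ (1 / (a - b))) ^ a =
      (d / c + 1) * ((d / c + 1) ^ (1 / (a - b))) ^ b := by
    rw [← Real.rpow_mul (by positivity), ← Real.rpow_mul (by positivity)]
    conv_rhs => enter [1]; rw [← Real.rpow_one (d / c + 1)]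
    rw [← Real.rpow_add (by positivity)]
    congr 1
    field_simp
    ring
  have h3 : 0 < ((d / c + 1) ^ (1 / (a - b))) ^ b := by positivity
  rw [h2, ← mul_assoc] at h1
  have h4 := le_of_mul_le_mul_right h1 h3
  rw [mul_add, mul_div_cancel₀ _ hc.ne'] at h4
  linarith

theorem rpow_neg_abs_le_rpow {e s : ℝ} (h1 : 1 ≤ s) (h3 : s ≤ 3) : (3 : ℝ) ^ (-|e|) ≤ s ^ e := by
  calc (3 : ℝ) ^ (-|e|) ≤ s ^ (-|e|) :=
        Real.rpow_le_rpow_of_nonpos (by linarith) h3 (by simp)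
    _ ≤ s ^ e := Real.rpow_le_rpow_of_exponent_le h1 (neg_abs_le e)

theorem rpow_le_rpow_abs {e s : ℝ} (h1 : 1 ≤ s) (h3 : s ≤ 3) : s ^ e ≤ (3 : ℝ) ^ |e| := by
  calc s ^ e ≤ s ^ |e| := Real.rpow_le_rpow_of_exponent_le h1 (le_abs_self e)
    _ ≤ _ := Real.rpow_le_rpow (by linarith) h3 (abs_nonneg e)

theorem lintegral_Ioo_inv {L : ℝ} (hL : 0 < L) :
    ∫⁻ s in Ioo (Real.exp (-L)) 1, ENNReal.ofReal s⁻¹ = ENNReal.ofReal L := by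
  have h1 : Real.exp (-L) ≤ 1 := Real.exp_le_one_iff.2 (by linarith)
  have h0 : ∀ s ∈ Icc (Real.exp (-L)) 1, s ≠ 0 := fun s hs =>
    ((Real.exp_pos _).trans_le hs.1).ne'
  have hc : ContinuousOn (fun s : ℝ => s⁻¹) (Icc (Real.exp (-L)) 1) :=
    continuousOn_id.inv₀ h0
  rw [← ofReal_integral_eq_lintegral_ofReal, ← integral_Ioc_eq_integral_Ioo,
    ← intervalIntegral.integral_of_le h1, integral_inv_of_pos (Real.exp_pos _) one_pos]
  · congr 1
    rw [one_div, Real.log_inv, Real.log_exp, neg_neg]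
  · exact hc.integrableOn_Icc.mono_set Ioo_subset_Icc_self
  · filter_upwards [ae_restrict_mem measurableSet_Ioo] with s hs
    exact inv_nonneg.2 ((Real.exp_pos _).trans hs.1).le

namespace HomogeneousGroup

namespace QuasiNorm

variable {N : ℕ} {G : HomogeneousGroup N} {ρ : QuasiNorm G} {𝕜 : Type*} [RCLike 𝕜]

/-- The extremal function of Bliss's inequality shows that the constant is sharp. -/
theorem HardyInequality.le_of_bliss_extremal (hN : 0 < N) {k p q α β C : ℝ}
    (h : ρ.HardyInequality 𝕜 p q α β C) (hC : 0 ≤ C) (hk : 0 < k) (hp : 1 < p) (hpq : p < q)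
    (hkα : k * (G.homDim * (p - 1) - α) = p - 1) (hkβ : k * (β + G.homDim) = q / p - q) :
    (ρ.sphereArea * k) ^ (1 + 1 / q - 1 / p) * blissConst p q ≤ C := by
  have hSk : 0 < ρ.sphereArea * k := mul_pos (ρ.sphereArea_pos hN) hk
  have hp0 : 0 < p := by linarith
  have hp1 : 0 < p - 1 := by linarith
  have hq0 : 0 < q := by linarith
  rw [blissConst]
  obtain ⟨r, hr⟩ : ∃ r, r = q / p - 1 := ⟨_, rfl⟩
  rw [← hr]
  have hr0 : 0 < r := by
    rw [hr, sub_pos, lt_div_iff₀ hp0]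
    linarith
  have hqc : q - 1 - r = q * ((p - 1) / p) := by
    rw [hr]
    field_simp
    ring
  have hqr : 1 + r < q := by
    have : 0 < q * ((p - 1) / p) := by positivity
    linarith
  have hpr : (1 / r + 1) * p = q / r := by
    have : p * (r + 1) = q := by rw [hr]; field_simp; ring
    rw [← this]
    field_simp
    ring
  have hE : 0 < blissMass q r := blissMass_pos hr0 (by linarith)
  have hr1 : ∀ s : ℝ, 0 < 1 + |s| ^ r := fun s => by positivity
  have key := h.radial hN hp0 hq0 hk (g := fun s => (1 + |s| ^ r) ^ (-(1 / r + 1)))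
    (by fun_prop) (fun s => (Real.rpow_pos_of_pos (hr1 s) _).le)
    (fun t ht => by rw [lintegral_Ioo_bliss_extremal hr0 ht]; exact ENNReal.ofReal_ne_top)
  have hL : ∫⁻ t in Ioi (0 : ℝ),
      (∫⁻ s in Ioo 0 t, ENNReal.ofReal ((1 + |s| ^ r) ^ (-(1 / r + 1)))) ^ q *
        ENNReal.ofReal (t ^ (k * (β + G.homDim) - 1)) =
      ENNReal.ofReal (blissMass q r / (q - 1 - r)) := by
    rw [← integral_bliss hr0 hqr, ofReal_integral_eq_lintegral_ofReal (integrableOn_bliss hr0 hqr)]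
    · refine setLIntegral_congr_fun measurableSet_Ioi fun t ht => ?_
      have ht : (0 : ℝ) < t := ht
      rw [lintegral_Ioo_bliss_extremal hr0 ht, ENNReal.ofReal_rpow_of_pos (by positivity),
        ← ENNReal.ofReal_mul (by positivity), hkβ, Real.mul_rpow ht.le (by positivity),
        ← Real.rpow_mul (by positivity), show q / p - q - 1 = r - q by rw [hr]; ring,
        mul_right_comm, ← Real.rpow_add ht]
      congr 3
      · ring
      · ring
    · filter_upwards [ae_restrict_mem measurableSet_Ioi] with t ht
      have ht : (0 : ℝ) < t := ht
      simp only [Pi.zero_apply]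
      positivity
  have hR : ∫⁻ t in Ioi (0 : ℝ), ENNReal.ofReal ((1 + |t| ^ r) ^ (-(1 / r + 1))) ^ p *
      ENNReal.ofReal (t ^ (k * (G.homDim + α - G.homDim * p) + p - 1)) =
      ENNReal.ofReal (blissMass q r) := by
    rw [blissMass, ofReal_integral_eq_lintegral_ofReal
      (integrableOn_rpow_mul_one_add_rpow_rpow hr0 (by norm_num)
        (by rw [zero_add]; gcongr; linarith))]
    · refine setLIntegral_congr_fun measurableSet_Ioi fun t ht => ?_
      have ht : (0 : ℝ) < t := ht
      rw [show k * (G.homDim + α - G.homDim * p) + p - 1 = 0 by linear_combination -hkα,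
        abs_of_pos ht, ENNReal.ofReal_rpow_of_pos (by positivity), ← Real.rpow_mul (by positivity),
        ← ENNReal.ofReal_mul (by positivity), neg_mul, hpr, mul_comm]
    · filter_upwards [ae_restrict_mem measurableSet_Ioi] with t ht
      have ht : (0 : ℝ) < t := ht
      simp only [Pi.zero_apply]
      positivity
  rw [hL, hR, hqc] at key
  have hZ : 0 < blissMass q r / (q * ((p - 1) / p)) := by positivity
  rw [← ENNReal.ofReal_mul (by positivity), ← ENNReal.ofReal_mul (by positivity),
    ENNReal.ofReal_rpow_of_pos (by positivity), ENNReal.ofReal_rpow_of_pos (by positivity),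
    ← ENNReal.ofReal_mul hC, ENNReal.ofReal_le_ofReal_iff (by positivity)] at key
  refine le_of_mul_le_mul_right (le_trans (le_of_eq ?_) key)
    (by positivity : 0 < (ρ.sphereArea * k * blissMass q r) ^ (1 / p))
  rw [Real.mul_rpow hSk.le hE.le, Real.mul_rpow (by positivity) hZ.le, ← Real.rpow_mul hSk.le,
    show blissMass q r / (q * ((p - 1) / p)) = p / (p - 1) / q * blissMass q r by field_simp,
    Real.mul_rpow (by positivity) hE.le, show (q + 1) * (1 / q) = 1 + 1 / q - 1 / p + 1 / p by
      field_simp; ring, Real.rpow_add hSk (1 + 1 / q - 1 / p)]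
  have e2 : blissMass q r ^ (1 / q) =
      blissMass q r ^ (1 / q - 1 / p) * blissMass q r ^ (1 / p) := by
    rw [← Real.rpow_add hE, sub_add_cancel]
  rw [e2]
  ring

/-- The functions `t ^ (-1 / p + ε)` on `(0, 1)`, whose `p`-th powers are barely integrable, show
that the constant is sharp for `p = q`. -/
theorem HardyInequality.le_of_powers (hN : 0 < N) {k p α β C : ℝ}
    (h : ρ.HardyInequality 𝕜 p p α β C) (hC : 0 ≤ C) (hk : 0 < k) (hp : 1 < p)
    (hkα : k * (G.homDim * (p - 1) - α) = p - 1) (hkβ : k * (β + G.homDim) = 1 - p) :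
    ρ.sphereArea * k * (p / (p - 1)) ≤ C := by
  have hSk : 0 < ρ.sphereArea * k := mul_pos (ρ.sphereArea_pos hN) hk
  have hp0 : 0 < p := by linarith
  have hp1 : 0 < p - 1 := by linarith
  have hc : 0 < 1 - 1 / p := by
    rw [sub_pos, div_lt_one hp0]
    exact hp
  have hε : ∀ ε : ℝ, 0 < ε → ρ.sphereArea * k ≤ C * (1 - 1 / p + ε) := by
    intro ε hε
    have hd : 0 < 1 - 1 / p + ε := by linarith
    set g : ℝ → ℝ := (Ioo (0 : ℝ) 1).indicator fun t => t ^ (-(1 / p) + ε) with hg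
    have hg1 : ∀ t ∈ Ioo (0 : ℝ) 1, g t = t ^ (-(1 / p) + ε) := fun t ht =>
      indicator_of_mem ht _
    have hgm : Measurable g := Measurable.indicator (by fun_prop) measurableSet_Ioo
    have hg0 : ∀ t, 0 ≤ g t := fun t => indicator_nonneg
      (fun t ht => Real.rpow_nonneg ht.1.le _) t
    have hgle : ∀ t ∈ Ioi (0 : ℝ), g t ≤ t ^ (-(1 / p) + ε) := fun t ht =>
      indicator_le_self' (fun _ _ => Real.rpow_nonneg (le_of_lt ht) _) t
    have key := h.radial hN hp0 hp0 hk hgm hg0 (fun t ht => by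
      refine ne_top_of_le_ne_top ?_ (setLIntegral_mono' measurableSet_Ioo fun s hs =>
        ENNReal.ofReal_le_ofReal (hgle s hs.1))
      rw [lintegral_Ioo_rpow (by linarith) ht]
      exact ENNReal.ofReal_ne_top)
    have hL : ENNReal.ofReal ((1 - 1 / p + ε)⁻¹ ^ p * (1 / (p * ε))) ≤
        ∫⁻ t in Ioi (0 : ℝ), (∫⁻ s in Ioo 0 t, ENNReal.ofReal (g s)) ^ p *
          ENNReal.ofReal (t ^ (k * (β + G.homDim) - 1)) := by
      have h1 := lintegral_Ioo_rpow (a := -1 + p * ε) (τ := 1)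
        (by have := mul_pos hp0 hε; linarith) one_pos
      rw [neg_add_cancel_comm, Real.one_rpow] at h1
      rw [ENNReal.ofReal_mul (by positivity), ← h1, ← lintegral_const_mul _ (by fun_prop)]
      refine le_trans (le_of_eq ?_)
        (lintegral_mono_set (Ioo_subset_Ioi_self : Ioo (0 : ℝ) 1 ⊆ Ioi 0))
      refine setLIntegral_congr_fun measurableSet_Ioo fun t ht => ?_
      have ht0 : 0 < t := ht.1
      rw [setLIntegral_congr_fun (g := fun s => ENNReal.ofReal (s ^ (-(1 / p) + ε)))
        measurableSet_Ioo fun s hs => by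
          simp only [hg1 s ⟨hs.1, hs.2.trans ht.2⟩], lintegral_Ioo_rpow (by linarith) ht0,
        show -(1 / p) + ε + 1 = 1 - 1 / p + ε by ring,
        ENNReal.ofReal_rpow_of_pos (by positivity), ← ENNReal.ofReal_mul (by positivity),
        ← ENNReal.ofReal_mul (by positivity), Real.inv_rpow hd.le,
        Real.div_rpow (by positivity) hd.le, ← Real.rpow_mul ht0.le, div_mul_eq_mul_div,
        ← Real.rpow_add ht0, inv_mul_eq_div, hkβ]
      congr 3
      field_simp
      ring
    have hR : ∫⁻ t in Ioi (0 : ℝ), ENNReal.ofReal (g t) ^ p *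
        ENNReal.ofReal (t ^ (k * (G.homDim + α - G.homDim * p) + p - 1)) ≤
        ENNReal.ofReal (1 / (p * ε)) := by
      have h1 := lintegral_Ioo_rpow (a := -1 + p * ε) (τ := 1)
        (by have := mul_pos hp0 hε; linarith) one_pos
      rw [neg_add_cancel_comm, Real.one_rpow] at h1
      rw [← h1, show k * (G.homDim + α - G.homDim * p) + p - 1 = 0 by linear_combination -hkα,
        ← lintegral_indicator measurableSet_Ioo]
      refine (lintegral_mono fun t => ?_).trans (setLIntegral_le_lintegral _ _)
      by_cases ht : t ∈ Ioo (0 : ℝ) 1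
      · have ht0 : 0 < t := ht.1
        rw [indicator_of_mem ht, hg1 t ht, Real.rpow_zero, ENNReal.ofReal_one, mul_one,
          ENNReal.ofReal_rpow_of_pos (by positivity), ← Real.rpow_mul ht0.le]
        refine le_of_eq ?_
        congr 2
        field_simp
      · rw [hg, indicator_of_notMem ht, ENNReal.ofReal_zero, ENNReal.zero_rpow_of_pos hp0]
        simp
    have key2 := (ENNReal.rpow_le_rpow (mul_le_mul_right hL
      (ENNReal.ofReal ((ρ.sphereArea * k) ^ (p + 1)))) (by positivity : 0 ≤ 1 / p)).trans
        (key.trans (mul_le_mul_right (ENNReal.rpow_le_rpow (mul_le_mul_right hR _)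
          (by positivity : 0 ≤ 1 / p)) _))
    rw [← ENNReal.ofReal_mul (by positivity), ← ENNReal.ofReal_mul (by positivity),
      ENNReal.ofReal_rpow_of_pos (by positivity), ENNReal.ofReal_rpow_of_pos (by positivity),
      ← ENNReal.ofReal_mul hC, ENNReal.ofReal_le_ofReal_iff (by positivity)] at key2
    have e1 : ((ρ.sphereArea * k) ^ (p + 1) * ((1 - 1 / p + ε)⁻¹ ^ p * (1 / (p * ε)))) ^ (1 / p) =
        ρ.sphereArea * k * (1 - 1 / p + ε)⁻¹ * (ρ.sphereArea * k * (1 / (p * ε))) ^ (1 / p) := by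
      rw [Real.rpow_add_one hSk.ne', show (ρ.sphereArea * k) ^ p * (ρ.sphereArea * k) *
        ((1 - 1 / p + ε)⁻¹ ^ p * (1 / (p * ε))) = (ρ.sphereArea * k) ^ p *
          (1 - 1 / p + ε)⁻¹ ^ p * (ρ.sphereArea * k * (1 / (p * ε))) by ring,
        ← Real.mul_rpow hSk.le (by positivity), Real.mul_rpow (by positivity) (by positivity),
        ← Real.rpow_mul (by positivity), mul_one_div_cancel hp0.ne', Real.rpow_one]
    rw [e1] at key2
    have key3 := le_of_mul_le_mul_right key2 (by positivity)
    rwa [← div_eq_mul_inv, div_le_iff₀ hd] at key3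
  have hlim : Tendsto (fun ε : ℝ => C * (1 - 1 / p + ε)) (𝓝[>] 0) (𝓝 (C * (1 - 1 / p + 0))) :=
    ((tendsto_const_nhds.add tendsto_id).const_mul C).mono_left nhdsWithin_le_nhds
  have h1 : ρ.sphereArea * k ≤ C * (1 - 1 / p + 0) :=
    ge_of_tendsto hlim (by filter_upwards [self_mem_nhdsWithin] with ε h using hε ε h)
  rw [add_zero] at h1
  rw [← mul_div_assoc, div_le_iff₀ hp1]
  calc ρ.sphereArea * k * p ≤ C * (1 - 1 / p) * p := by gcongr
    _ = C * (p - 1) := by field_simp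

/-- Scaling: the Hardy inequality forces the balance condition between the exponents. -/
theorem HardyInequality.balance (hN : 0 < N) {p q α β C : ℝ}
    (h : ρ.HardyInequality 𝕜 p q α β C) (hC : 0 ≤ C) (hp : 0 < p) (hq : 0 < q) :
    q * (α + G.homDim) - p * (β + G.homDim) = p * q * G.homDim := by
  have hS := ρ.sphereArea_pos hN
  set e := 1 * (β + G.homDim) - 1 with he
  set d := 1 * (G.homDim + α - G.homDim * p) + p - 1 with hd
  have hl : ∀ l : ℝ, 0 < l → (ρ.sphereArea ^ (q + 1) * 3 ^ (-|e|)) ^ (1 / q) *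
      l ^ (1 + (e + 1) / q) ≤
      C * (ρ.sphereArea * 3 ^ |d|) ^ (1 / p) * l ^ ((d + 1) / p) := by
    intro l hl
    -- The density is `1` on `(l, 2 l)`; the left-hand side is estimated on `(2 l, 3 l)`, where the
    -- primitive equals `l`.
    set g : ℝ → ℝ := (Ioo l (2 * l)).indicator 1 with hg
    have hint : ∀ s : Set ℝ, ∫⁻ t in s, ENNReal.ofReal (g t) =
        ∫⁻ t in s, (Ioo l (2 * l)).indicator 1 t := fun s => by
      refine lintegral_congr fun t => ?_
      by_cases ht : t ∈ Ioo l (2 * l) <;> simp [hg, ht]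
    have key := h.radial hN hp hq one_pos (g := g) (measurable_one.indicator measurableSet_Ioo)
      (fun t => indicator_nonneg (fun _ _ => zero_le_one) t) (fun t ht => by
        rw [hint, lintegral_indicator_one measurableSet_Ioo]
        exact ((measure_mono (subset_univ _)).trans_lt (by simp)).ne)
    rw [mul_one, ← he, ← hd] at key
    have hL : ENNReal.ofReal (l ^ q * (l ^ e * 3 ^ (-|e|)) * l) ≤
        ∫⁻ t in Ioi (0 : ℝ), (∫⁻ s in Ioo 0 t, ENNReal.ofReal (g s)) ^ q *
          ENNReal.ofReal (t ^ e) := by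
      have hsub : Ioo (2 * l) (3 * l) ⊆ Ioi 0 := fun t ht => lt_trans (by linarith) ht.1
      refine le_trans ?_ (lintegral_mono_set hsub)
      refine le_trans (le_of_eq ?_) (setLIntegral_mono' (f := fun _ =>
        ENNReal.ofReal (l ^ q * (l ^ e * 3 ^ (-|e|)))) measurableSet_Ioo fun t ht => ?_)
      · rw [setLIntegral_const, Real.volume_Ioo, ← ENNReal.ofReal_mul (by positivity)]
        congr 2
        ring
      · have ht0 : 0 < t := hsub ht
        have h1 : Ioo l (2 * l) ∩ Ioo 0 t = Ioo l (2 * l) := by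
          refine inter_eq_left.2 fun s hs => ⟨hl.trans hs.1, hs.2.trans ht.1⟩
        rw [hint, lintegral_indicator_one measurableSet_Ioo,
          Measure.restrict_apply measurableSet_Ioo, h1, Real.volume_Ioo,
          show 2 * l - l = l by ring, ENNReal.ofReal_rpow_of_pos hl,
          ← ENNReal.ofReal_mul (by positivity)]
        refine ENNReal.ofReal_le_ofReal (mul_le_mul_of_nonneg_left ?_ (by positivity))
        have h2 : (3 : ℝ) ^ (-|e|) ≤ (t / l) ^ e := by
          refine rpow_neg_abs_le_rpow ?_ ?_
          · rw [le_div_iff₀ hl]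
            linarith [ht.1]
          · rw [div_le_iff₀ hl]
            exact ht.2.le
        rw [Real.div_rpow ht0.le hl.le, le_div_iff₀ (by positivity)] at h2
        linarith
    have hR : ∫⁻ t in Ioi (0 : ℝ), ENNReal.ofReal (g t) ^ p * ENNReal.ofReal (t ^ d) ≤
        ENNReal.ofReal (l ^ d * 3 ^ |d| * l) := by
      have h1 : ENNReal.ofReal (l ^ d * 3 ^ |d| * l) =
          ∫⁻ t in Ioo l (2 * l), ENNReal.ofReal (l ^ d * 3 ^ |d|) := by
        rw [setLIntegral_const, Real.volume_Ioo, ← ENNReal.ofReal_mul (by positivity)]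
        congr 2
        ring
      rw [h1, ← lintegral_indicator measurableSet_Ioo]
      refine (lintegral_mono fun t => ?_).trans (setLIntegral_le_lintegral _ _)
      by_cases ht : t ∈ Ioo l (2 * l)
      · have ht0 : 0 < t := hl.trans ht.1
        rw [hg, indicator_of_mem ht, indicator_of_mem ht, Pi.one_apply, ENNReal.ofReal_one,
          ENNReal.one_rpow, one_mul]
        refine ENNReal.ofReal_le_ofReal ?_
        have h2 : (t / l) ^ d ≤ (3 : ℝ) ^ |d| := by
          refine rpow_le_rpow_abs ?_ ?_
          · rw [le_div_iff₀ hl]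
            linarith [ht.1]
          · rw [div_le_iff₀ hl]
            linarith [ht.2]
        rw [Real.div_rpow ht0.le hl.le, div_le_iff₀ (by positivity)] at h2
        linarith
      · rw [hg, indicator_of_notMem ht, ENNReal.ofReal_zero, ENNReal.zero_rpow_of_pos hp]
        simp
    have key2 := (ENNReal.rpow_le_rpow (mul_le_mul_right hL
      (ENNReal.ofReal (ρ.sphereArea ^ (q + 1)))) (by positivity : 0 ≤ 1 / q)).trans
        (key.trans (mul_le_mul_right (ENNReal.rpow_le_rpow (mul_le_mul_right hR _)
          (by positivity : 0 ≤ 1 / p)) _))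
    rw [← ENNReal.ofReal_mul (by positivity), ← ENNReal.ofReal_mul (by positivity),
      ENNReal.ofReal_rpow_of_pos (by positivity), ENNReal.ofReal_rpow_of_pos (by positivity),
      ← ENNReal.ofReal_mul hC, ENNReal.ofReal_le_ofReal_iff (by positivity)] at key2
    refine le_trans (le_of_eq ?_) (key2.trans (le_of_eq ?_))
    · rw [show ρ.sphereArea ^ (q + 1) * (l ^ q * (l ^ e * 3 ^ (-|e|)) * l) =
        ρ.sphereArea ^ (q + 1) * 3 ^ (-|e|) * (l ^ q * l ^ e * l) by ring,
        Real.mul_rpow (x := ρ.sphereArea ^ (q + 1) * 3 ^ (-|e|)) (by positivity) (by positivity),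
        ← Real.rpow_add hl,
        ← Real.rpow_add_one hl.ne', ← Real.rpow_mul hl.le]
      congr 2
      field_simp
      ring
    · rw [show ρ.sphereArea * (l ^ d * 3 ^ |d| * l) =
        ρ.sphereArea * 3 ^ |d| * (l ^ d * l) by ring,
        Real.mul_rpow (by positivity) (by positivity), ← Real.rpow_add_one hl.ne',
        ← Real.rpow_mul hl.le, _root_.mul_assoc]
      congr 3
      ring
  have := rpow_exponent_eq_of_le (by positivity) hl
  rw [he, hd] at this
  field_simp at this
  linarith

/-- Testing on `|x| ^ (-Q)`, truncated near the origin, the Hardy inequality forces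
`α < Q (p - 1)`. -/
theorem HardyInequality.lt (hN : 0 < N) {p q α β C : ℝ}
    (h : ρ.HardyInequality 𝕜 p q α β C) (hC : 0 ≤ C) (hp : 1 < p) (hq : 0 < q) :
    α < G.homDim * (p - 1) := by
  by_contra hα
  have hS := ρ.sphereArea_pos hN
  have hp0 : 0 < p := by linarith
  set e := 1 * (β + G.homDim) - 1 with he
  set d := 1 * (G.homDim + α - G.homDim * p) + p - 1 with hd
  have hdp : p - 1 ≤ d := by
    rw [hd]
    linarith
  have hl : ∀ L : ℝ, 0 < L → (ρ.sphereArea ^ (q + 1) * 3 ^ (-|e|)) ^ (1 / q) *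
      L ^ (1 : ℝ) ≤ C * ρ.sphereArea ^ (1 / p) * L ^ (1 / p) := by
    intro L hL0
    -- The density `1 / t` has mass `L` on `(exp (-L), 1)`; since `p > 1`, the right-hand side only
    -- grows like `L ^ (1 / p)`.
    set g : ℝ → ℝ := (Ioo (Real.exp (-L)) 1).indicator fun t => t⁻¹ with hg
    have hgpos : ∀ t ∈ Ioo (Real.exp (-L)) 1, 0 < t := fun t ht => (Real.exp_pos _).trans ht.1
    have hint : ∀ t : ℝ, ENNReal.ofReal (g t) =
        (Ioo (Real.exp (-L)) 1).indicator (fun t => ENNReal.ofReal t⁻¹) t := fun t => by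
      by_cases ht : t ∈ Ioo (Real.exp (-L)) 1 <;> simp [hg, ht]
    have key := h.radial hN hp0 hq one_pos (g := g)
      (measurable_inv.indicator measurableSet_Ioo)
      (fun t => indicator_nonneg (fun t ht => inv_nonneg.2 (hgpos t ht).le) t) (fun t ht => by
        refine ne_top_of_le_ne_top ?_ (setLIntegral_le_lintegral _ _)
        rw [lintegral_congr hint, lintegral_indicator measurableSet_Ioo, lintegral_Ioo_inv hL0]
        exact ENNReal.ofReal_ne_top)
    rw [mul_one, ← he, ← hd] at key
    have hL : ENNReal.ofReal (L ^ q * 3 ^ (-|e|)) ≤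
        ∫⁻ t in Ioi (0 : ℝ), (∫⁻ s in Ioo 0 t, ENNReal.ofReal (g s)) ^ q *
          ENNReal.ofReal (t ^ e) := by
      have hsub : Ioo (1 : ℝ) 2 ⊆ Ioi 0 := fun t ht => lt_trans (by linarith) ht.1
      refine le_trans ?_ (lintegral_mono_set hsub)
      refine le_trans (le_of_eq ?_) (setLIntegral_mono' (f := fun _ =>
        ENNReal.ofReal (L ^ q * 3 ^ (-|e|))) measurableSet_Ioo fun t ht => ?_)
      · rw [setLIntegral_const, Real.volume_Ioo]
        norm_num
      · have ht0 : 0 < t := hsub ht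
        have h1 : Ioo (Real.exp (-L)) 1 ∩ Ioo 0 t = Ioo (Real.exp (-L)) 1 :=
          inter_eq_left.2 fun s hs => ⟨hgpos s hs, hs.2.trans ht.1⟩
        rw [lintegral_congr hint, lintegral_indicator measurableSet_Ioo,
          Measure.restrict_restrict measurableSet_Ioo, h1, lintegral_Ioo_inv hL0,
          ENNReal.ofReal_rpow_of_pos hL0, ← ENNReal.ofReal_mul (by positivity)]
        exact ENNReal.ofReal_le_ofReal (mul_le_mul_of_nonneg_left
          (rpow_neg_abs_le_rpow ht.1.le (by linarith [ht.2])) (by positivity))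
    have hR : ∫⁻ t in Ioi (0 : ℝ), ENNReal.ofReal (g t) ^ p * ENNReal.ofReal (t ^ d) ≤
        ENNReal.ofReal L := by
      rw [← lintegral_Ioo_inv hL0, ← lintegral_indicator measurableSet_Ioo]
      refine (lintegral_mono fun t => ?_).trans (setLIntegral_le_lintegral _ _)
      by_cases ht : t ∈ Ioo (Real.exp (-L)) 1
      · have ht0 : 0 < t := hgpos t ht
        rw [hg, indicator_of_mem ht, indicator_of_mem ht,
          ENNReal.ofReal_rpow_of_pos (by positivity), ← ENNReal.ofReal_mul (by positivity)]
        refine ENNReal.ofReal_le_ofReal ?_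
        rw [← Real.rpow_neg_one, ← Real.rpow_mul ht0.le, ← Real.rpow_add ht0]
        exact Real.rpow_le_rpow_of_exponent_ge ht0 ht.2.le (by linarith)
      · rw [hg, indicator_of_notMem ht, ENNReal.ofReal_zero, ENNReal.zero_rpow_of_pos hp0]
        simp
    have key2 := (ENNReal.rpow_le_rpow (mul_le_mul_right hL
      (ENNReal.ofReal (ρ.sphereArea ^ (q + 1)))) (by positivity : 0 ≤ 1 / q)).trans
        (key.trans (mul_le_mul_right (ENNReal.rpow_le_rpow (mul_le_mul_right hR _)
          (by positivity : 0 ≤ 1 / p)) _))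
    rw [← ENNReal.ofReal_mul (by positivity), ← ENNReal.ofReal_mul (by positivity),
      ENNReal.ofReal_rpow_of_pos (by positivity), ENNReal.ofReal_rpow_of_pos (by positivity),
      ← ENNReal.ofReal_mul hC, ENNReal.ofReal_le_ofReal_iff (by positivity)] at key2
    refine le_trans (le_of_eq ?_) (key2.trans (le_of_eq ?_))
    · rw [show ρ.sphereArea ^ (q + 1) * (L ^ q * 3 ^ (-|e|)) =
        ρ.sphereArea ^ (q + 1) * 3 ^ (-|e|) * L ^ q by ring,
        Real.mul_rpow (x := ρ.sphereArea ^ (q + 1) * 3 ^ (-|e|)) (by positivity) (by positivity),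
        ← Real.rpow_mul hL0.le,
        mul_one_div_cancel hq.ne']
    · rw [Real.mul_rpow hS.le hL0.le, _root_.mul_assoc]
  have := rpow_exponent_eq_of_le (by positivity) hl
  rw [eq_div_iff hp0.ne'] at this
  linarith

end QuasiNorm

end HomogeneousGroup

/-! ### Growth of the Gamma function and the limit of the constants -/

theorem integrableOn_Gamma_integrand {x : ℝ} (hx : 0 < x) :
    IntegrableOn (fun t : ℝ => Real.exp (-t) * t ^ x) (Ioi 0) := by
  have := Real.GammaIntegral_convergent (s := x + 1) (by linarith)
  simpa using this

theorem rpow_mul_exp_neg_le_Gamma_add_one {x : ℝ} (hx : 0 < x) :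
    x ^ x * Real.exp (-x) ≤ Real.Gamma (x + 1) := by
  rw [Real.Gamma_eq_integral (by linarith), add_sub_cancel_right]
  calc x ^ x * Real.exp (-x) = ∫ t in Ioi x, Real.exp (-t) * x ^ x := by
        rw [integral_mul_const, integral_exp_neg_Ioi, mul_comm]
    _ ≤ ∫ t in Ioi x, Real.exp (-t) * t ^ x := by
        refine setIntegral_mono_on ((integrableOn_exp_neg_Ioi x).mul_const _)
          ((integrableOn_Gamma_integrand hx).mono_set (Ioi_subset_Ioi hx.le)) measurableSet_Ioi
          fun t ht => ?_
        have : x ≤ t := le_of_lt ht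
        gcongr
    _ ≤ _ := setIntegral_mono_set (integrableOn_Gamma_integrand hx)
        (by
          filter_upwards [ae_restrict_mem measurableSet_Ioi] with t ht
          have ht : (0 : ℝ) < t := ht
          simp only [Pi.zero_apply]
          positivity) (Ioi_subset_Ioi hx.le).eventuallyLE

/-- The bound follows from `s * exp (-s) ≤ exp (-1)` at `s = t / (x + 1)`. -/
theorem Gamma_add_one_le {x : ℝ} (hx : 0 < x) :
    Real.Gamma (x + 1) ≤ (x + 1) ^ (x + 1) * Real.exp (-x) := by
  have hx1 : 0 < x + 1 := by linarith
  have hi : IntegrableOn (fun t : ℝ => Real.exp (-(x + 1)⁻¹ * t)) (Ioi 0) :=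
    integrableOn_exp_mul_Ioi (by simpa using hx1) 0
  rw [Real.Gamma_eq_integral hx1, add_sub_cancel_right]
  calc ∫ t in Ioi (0 : ℝ), Real.exp (-t) * t ^ x
      ≤ ∫ t in Ioi (0 : ℝ), (x + 1) ^ x * Real.exp (-x) * Real.exp (-(x + 1)⁻¹ * t) := by
        refine setIntegral_mono_on (integrableOn_Gamma_integrand hx) (hi.const_mul _)
          measurableSet_Ioi fun t ht => ?_
        have ht : (0 : ℝ) < t := ht
        have h1 : t / (x + 1) ≤ Real.exp (t / (x + 1) - 1) := by
          have := Real.add_one_le_exp (t / (x + 1) - 1)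
          linarith
        have h2 := Real.rpow_le_rpow (by positivity) h1 hx.le
        rw [Real.div_rpow ht.le hx1.le, div_le_iff₀ (by positivity), ← Real.exp_mul] at h2
        calc Real.exp (-t) * t ^ x
            ≤ Real.exp (-t) * (Real.exp ((t / (x + 1) - 1) * x) * (x + 1) ^ x) := by gcongr
          _ = (x + 1) ^ x * (Real.exp (-t) * Real.exp ((t / (x + 1) - 1) * x)) := by ring
          _ = (x + 1) ^ x * (Real.exp (-x) * Real.exp (-(x + 1)⁻¹ * t)) := by
              rw [← Real.exp_add, ← Real.exp_add]
              congr 2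
              field_simp
              ring
          _ = _ := by ring
    _ = (x + 1) ^ x * Real.exp (-x) * (x + 1) := by
        rw [integral_const_mul, integral_exp_mul_Ioi (by simpa using hx1)]
        simp
    _ = _ := by
        rw [Real.rpow_add_one hx1.ne']
        ring

/-- The leading order of Stirling's formula. -/
theorem tendsto_log_Gamma_div :
    Tendsto (fun x : ℝ => (Real.log (Real.Gamma x) - (x * Real.log x - x)) / x) atTop (𝓝 0) := by
  have hlog : Tendsto (fun x : ℝ => Real.log x / x) atTop (𝓝 0) :=
    Real.isLittleO_log_id_atTop.tendsto_div_nhds_zero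
  have hinv : Tendsto (fun x : ℝ => 2 / x) atTop (𝓝 0) :=
    tendsto_const_nhds.div_atTop tendsto_id
  have hlog' : Tendsto (fun x : ℝ => -(Real.log x / x)) atTop (𝓝 0) := by simpa using hlog.neg
  refine tendsto_of_tendsto_of_tendsto_of_le_of_le' hlog' hinv ?_ ?_
  · filter_upwards [eventually_gt_atTop 0] with x hx
    have hG := Real.Gamma_pos_of_pos hx
    have h := Real.log_le_log (by positivity) (rpow_mul_exp_neg_le_Gamma_add_one hx)
    rw [Real.Gamma_add_one hx.ne', Real.log_mul hx.ne' hG.ne', Real.log_mul (by positivity)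
      (Real.exp_pos _).ne', Real.log_exp, Real.log_rpow hx] at h
    rw [← neg_div]
    gcongr
    linarith
  · filter_upwards [eventually_ge_atTop 1] with x hx1
    have hx : 0 < x := by linarith
    have hG := Real.Gamma_pos_of_pos hx
    have h := Real.log_le_log (Real.Gamma_pos_of_pos (by linarith)) (Gamma_add_one_le hx)
    rw [Real.Gamma_add_one hx.ne', Real.log_mul hx.ne' hG.ne', Real.log_mul (by positivity)
      (Real.exp_pos _).ne', Real.log_exp, Real.log_rpow (by linarith)] at h
    have h2 : Real.log (x + 1) ≤ Real.log x + 1 / x := by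
      have := Real.log_le_sub_one_of_pos (x := 1 + 1 / x) (by positivity)
      rw [show x + 1 = x * (1 + 1 / x) by field_simp, Real.log_mul hx.ne' (by positivity)]
      linarith
    have h3 : (x + 1) * Real.log (x + 1) ≤ (x + 1) * (Real.log x + 1 / x) := by gcongr
    have h4 : (x + 1) * (1 / x) ≤ 2 := by
      rw [mul_one_div, div_le_iff₀ hx]
      linarith
    gcongr
    nlinarith

theorem tendsto_mul_log_Gamma_div {a : ℝ} (ha : 0 < a) :
    Tendsto (fun r : ℝ => r * Real.log (Real.Gamma (a / r)) + a * Real.log r) (𝓝[>] 0)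
      (𝓝 (a * Real.log a - a)) := by
  have h1 : Tendsto (fun r : ℝ => a / r) (𝓝[>] 0) atTop := by
    simp only [div_eq_mul_inv]
    exact tendsto_inv_nhdsGT_zero.const_mul_atTop ha
  have h2 := ((tendsto_log_Gamma_div.comp h1).const_mul a).add_const (a * Real.log a - a)
  rw [mul_zero, zero_add] at h2
  refine h2.congr' ?_
  filter_upwards [self_mem_nhdsWithin] with r (hr : (0 : ℝ) < r)
  simp only [Function.comp]
  rw [Real.log_div ha.ne' hr.ne']
  field_simp
  ring

/-- By Stirling's formula the terms in `log r` cancel. -/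
theorem tendsto_blissMass_rpow {q : ℝ} (hq : 1 < q) :
    Tendsto (fun r : ℝ => blissMass q r ^ (-(r / q))) (𝓝[>] 0)
      (𝓝 (q * (q - 1) ^ (1 / q - 1))) := by
  have hq0 : 0 < q := by linarith
  have hq1 : 0 < q - 1 := by linarith
  have hr : Tendsto (fun r : ℝ => r * Real.log r) (𝓝[>] 0) (𝓝 0) := by
    have := Real.continuous_mul_log.tendsto 0
    rw [zero_mul] at this
    exact this.mono_left nhdsWithin_le_nhds
  have h := ((((tendsto_mul_log_Gamma_div hq0).sub (tendsto_mul_log_Gamma_div one_pos)).sub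
    (tendsto_mul_log_Gamma_div hq1)).add hr).const_mul (1 / q)
  have h2 := (Real.continuous_exp.tendsto _).comp h
  have e : Real.exp (1 / q * (q * Real.log q - q - (1 * Real.log 1 - 1) -
      ((q - 1) * Real.log (q - 1) - (q - 1)) + 0)) = q * (q - 1) ^ (1 / q - 1) := by
    rw [Real.log_one, Real.rpow_def_of_pos hq1]
    conv_rhs => enter [1]; rw [← Real.exp_log hq0]
    rw [← Real.exp_add]
    congr 1
    field_simp
    ring
  rw [e] at h2
  refine h2.congr' ?_
  filter_upwards [self_mem_nhdsWithin] with r (hr : (0 : ℝ) < r)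
  have g1 : 0 < Real.Gamma (1 / r) := Real.Gamma_pos_of_pos (by positivity)
  have g2 : 0 < Real.Gamma ((q - 1) / r) := Real.Gamma_pos_of_pos (by positivity)
  have g3 : 0 < Real.Gamma (q / r) := Real.Gamma_pos_of_pos (by positivity)
  have hE := blissMass_pos hr hq
  rw [Real.rpow_def_of_pos hE, blissMass_eq hr hq, Real.log_div (by positivity) (by positivity),
    Real.log_mul g1.ne' g2.ne', Real.log_mul hr.ne' g3.ne']
  simp only [Function.comp]
  congr 1
  field_simp
  ring

/-- As `s` increases to `q`, the sharp constants in Bliss's inequality converge to the constant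
in Hardy's inequality. -/
theorem tendsto_blissConst {q : ℝ} (hq : 1 < q) :
    Tendsto (fun s : ℝ => blissConst s q) (𝓝[<] q) (𝓝 (q / (q - 1))) := by
  have hq0 : 0 < q := by linarith
  have hq1 : 0 < q - 1 := by linarith
  have hr : Tendsto (fun s : ℝ => q / s - 1) (𝓝[<] q) (𝓝[>] 0) := by
    refine tendsto_nhdsWithin_iff.2 ⟨?_, ?_⟩
    · have : ContinuousAt (fun s : ℝ => q / s - 1) q :=
        (continuousAt_const.div continuousAt_id hq0.ne').sub continuousAt_const
      have h := this.tendsto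
      simp only [div_self hq0.ne', sub_self] at h
      exact h.mono_left nhdsWithin_le_nhds
    · filter_upwards [Ioo_mem_nhdsLT hq0] with s hs
      rw [mem_Ioi, sub_pos, lt_div_iff₀ hs.1]
      linarith [hs.2]
  have h1 := (tendsto_blissMass_rpow hq).comp hr
  have h2 : Tendsto (fun s : ℝ => (s / (s - 1) / q) ^ (1 / q)) (𝓝[<] q)
      (𝓝 ((q / (q - 1) / q) ^ (1 / q))) := by
    have : ContinuousAt (fun s : ℝ => (s / (s - 1) / q) ^ (1 / q)) q :=
      ((continuousAt_id.div (continuousAt_id.sub continuousAt_const) hq1.ne').div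
        continuousAt_const hq0.ne').rpow_const (Or.inr (by positivity))
    exact this.tendsto.mono_left nhdsWithin_le_nhds
  have h3 := h2.mul h1
  have e : (q / (q - 1) / q) ^ (1 / q) * (q * (q - 1) ^ (1 / q - 1)) = q / (q - 1) := by
    rw [show q / (q - 1) / q = (q - 1)⁻¹ by field_simp, Real.inv_rpow hq1.le,
      Real.rpow_sub_one hq1.ne']
    field_simp
  rw [e] at h3
  refine h3.congr' ?_
  filter_upwards [Ioo_mem_nhdsLT hq0] with s hs
  have hs0 : 0 < s := hs.1
  simp only [Function.comp, blissConst]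
  congr 2
  field_simp
  ring

namespace HomogeneousGroup

namespace QuasiNorm

theorem hardyConst_eq {S Q α p q : ℝ} (hS : 0 < S) (hp : 1 < p) (hpq : p < q)
    (hα : α < Q * (p - 1)) :
    hardyConst S Q α p q =
      (S * ((p - 1) / (Q * (p - 1) - α))) ^ (1 + 1 / q - 1 / p) * blissConst p q := by
  have hp0 : 0 < p := by linarith
  have hp1 : 0 < p - 1 := by linarith
  have hq0 : 0 < q := by linarith
  have hqp : 0 < q - p := by linarith
  have hα' : 0 < Q * (p - 1) - α := by linarith
  have hr : q / p - 1 = (q - p) / p := by field_simp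
  have hr0 : 0 < q / p - 1 := by rw [hr]; positivity
  have hM : (q - p) / p * Real.Gamma (p * q / (q - p)) /
      (Real.Gamma (p / (q - p)) * Real.Gamma (p * (q - 1) / (q - p))) =
      (blissMass q (q / p - 1))⁻¹ := by
    rw [blissMass_eq hr0 (by linarith), inv_div, hr]
    rw [show q / ((q - p) / p) = p * q / (q - p) by field_simp,
      show 1 / ((q - p) / p) = p / (q - p) by field_simp,
      show (q - 1) / ((q - p) / p) = p * (q - 1) / (q - p) by field_simp]
  have hE := blissMass_pos hr0 (by linarith : 1 < q)
  rw [hardyConst, hM, blissConst, Real.mul_rpow hS.le (by positivity), Real.inv_rpow hE.le,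
    ← Real.rpow_neg hE.le, show -(1 / p - 1 / q) = 1 / q - 1 / p by ring,
    show 1 / (p / (p - 1)) + 1 / q = 1 + 1 / q - 1 / p by field_simp; ring]
  ring

theorem tendsto_hardyConst {S Q α q : ℝ} (hS : 0 < S) (hq : 1 < q) (hα : α < Q * (q - 1)) :
    Tendsto (fun s => hardyConst S Q α s q) (𝓝[<] q) (𝓝 (q * S / (Q * (q - 1) - α))) := by
  have hq0 : 0 < q := by linarith
  have hq1 : 0 < q - 1 := by linarith
  have hα' : 0 < Q * (q - 1) - α := by linarith
  have h1 : Tendsto (fun s => (S * ((s - 1) / (Q * (s - 1) - α))) ^ (1 + 1 / q - 1 / s)) (𝓝[<] q)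
      (𝓝 ((S * ((q - 1) / (Q * (q - 1) - α))) ^ (1 + 1 / q - 1 / q))) := by
    have hc : ContinuousAt (fun s => (S * ((s - 1) / (Q * (s - 1) - α))) ^ (1 + 1 / q - 1 / s)) q :=
      (continuousAt_const.mul ((continuousAt_id.sub continuousAt_const).div
        ((continuousAt_const.mul (continuousAt_id.sub continuousAt_const)).sub continuousAt_const)
        hα'.ne')).rpow (continuousAt_const.sub (continuousAt_const.div continuousAt_id hq0.ne'))
        (Or.inl (mul_pos hS (div_pos hq1 hα')).ne')
    exact hc.tendsto.mono_left nhdsWithin_le_nhds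
  have h2 := h1.mul (tendsto_blissConst hq)
  have e : (S * ((q - 1) / (Q * (q - 1) - α))) ^ (1 + 1 / q - 1 / q) * (q / (q - 1)) =
      q * S / (Q * (q - 1) - α) := by
    rw [add_sub_cancel_right, Real.rpow_one]
    field_simp
  rw [e] at h2
  refine h2.congr' ?_
  have hcα : ∀ᶠ s in 𝓝 q, α < Q * (s - 1) :=
    (continuous_const.mul (continuous_id.sub continuous_const)).continuousAt.eventually
      (lt_mem_nhds hα)
  filter_upwards [Ioo_mem_nhdsLT hq, mem_nhdsWithin_of_mem_nhds hcα] with s hs hsα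
  exact (hardyConst_eq hS hs.1 hs.2 hsα).symm

end QuasiNorm

end HomogeneousGroup

theorem mainTheorem1 {N : ℕ} (hN : 0 < N) (G : HomogeneousGroup N)
    (ρ : HomogeneousGroup.QuasiNorm G) (𝕜 : Type*) [RCLike 𝕜]
    (p q α β : ℝ) (hp : 1 < p) (hpq : p ≤ q) :
    ((∃ C : ℝ, 0 ≤ C ∧ ρ.HardyInequality 𝕜 p q α β C) ↔
      (α < G.homDim * (p - 1) ∧
        q * (α + G.homDim) - p * (β + G.homDim) = p * q * G.homDim)) ∧
    (α < G.homDim * (p - 1) ∧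
        q * (α + G.homDim) - p * (β + G.homDim) = p * q * G.homDim →
      (∀ u : (Fin N → ℝ) → 𝕜, Measurable u →
        ∫⁻ x, ‖u x‖ₑ ^ p * ENNReal.ofReal (ρ.toFun x ^ α) < ∞ →
        ∀ R : ℝ, IntegrableOn u (ρ.ball 0 R)) ∧
      (p < q →
        IsLeast {C : ℝ | 0 ≤ C ∧ ρ.HardyInequality 𝕜 p q α β C}
          (HomogeneousGroup.QuasiNorm.hardyConst ρ.sphereArea G.homDim α p q)) ∧
      (p = q →
        IsLeast {C : ℝ | 0 ≤ C ∧ ρ.HardyInequality 𝕜 p q α β C}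
          (p * ρ.sphereArea / (G.homDim * (p - 1) - α)) ∧
        Tendsto (fun s : ℝ =>
            HomogeneousGroup.QuasiNorm.hardyConst ρ.sphereArea G.homDim α s q)
          (𝓝[<] q) (𝓝 (p * ρ.sphereArea / (G.homDim * (p - 1) - α))))) := by
  have hp0 : 0 < p := by linarith
  have hp1 : 0 < p - 1 := by linarith
  have hq0 : 0 < q := by linarith
  have hS := ρ.sphereArea_pos hN
  have hsharp : α < G.homDim * (p - 1) ∧
        q * (α + G.homDim) - p * (β + G.homDim) = p * q * G.homDim →
      (p < q →
        IsLeast {C : ℝ | 0 ≤ C ∧ ρ.HardyInequality 𝕜 p q α β C}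
          (HomogeneousGroup.QuasiNorm.hardyConst ρ.sphereArea G.homDim α p q)) ∧
      (p = q →
        IsLeast {C : ℝ | 0 ≤ C ∧ ρ.HardyInequality 𝕜 p q α β C}
          (p * ρ.sphereArea / (G.homDim * (p - 1) - α))) := by
    rintro ⟨hα, hβ⟩
    have hα' : 0 < G.homDim * (p - 1) - α := by linarith
    -- The radius `t ^ k` turns the weights of the group into those of the half-line.
    obtain ⟨k, hk⟩ : ∃ k, k = (p - 1) / (G.homDim * (p - 1) - α) := ⟨_, rfl⟩
    have hk0 : 0 < k := hk ▸ div_pos hp1 hα'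
    have hkα : k * (G.homDim * (p - 1) - α) = p - 1 := by
      rw [hk, div_mul_cancel₀ _ hα'.ne']
    have hkβ : k * (β + G.homDim) = q / p - q := by
      rw [eq_sub_iff_add_eq, eq_div_iff hp0.ne']
      linear_combination -k * hβ - q * hkα
    have hSk : 0 < ρ.sphereArea * k := mul_pos hS hk0
    refine ⟨fun hlt => ?_, ?_⟩
    · have hr : 0 < q / p - 1 := by
        rw [sub_pos, lt_div_iff₀ hp0]
        linarith
      have hE := blissMass_pos (q := q) hr (by linarith)
      rw [HomogeneousGroup.QuasiNorm.hardyConst_eq hS hp hlt hα, ← hk]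
      refine ⟨⟨?_, ρ.hardyInequality_of_lintegral_hardy hN 𝕜 hk0 hp hq0 hkα hkβ
        fun f hf => lintegral_bliss hp hlt hf⟩, fun C hC =>
        hC.2.le_of_bliss_extremal hN hC.1 hk0 hp hlt hkα hkβ⟩
      rw [blissConst]
      positivity
    · rintro rfl
      rw [show p * ρ.sphereArea / (G.homDim * (p - 1) - α) =
        ρ.sphereArea * k * (p / (p - 1)) by rw [hk]; field_simp]
      refine ⟨⟨by positivity, ?_⟩, fun C hC => hC.2.le_of_powers hN hC.1 hk0 hp hkα
        (by rw [hkβ, div_self hp0.ne'])⟩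
      have := ρ.hardyInequality_of_lintegral_hardy hN 𝕜 hk0 hp hq0 hkα hkβ
        fun f hf => lintegral_hardy hp hf
      rwa [add_sub_cancel_right, Real.rpow_one] at this
  refine ⟨⟨?_, fun h => ?_⟩, fun h => ⟨fun u hu hfin R => ρ.integrableOn_ball hN hp h.1 hu hfin R,
    (hsharp h).1, fun hpq' => ⟨(hsharp h).2 hpq', ?_⟩⟩⟩
  · rintro ⟨C, hC, hH⟩
    exact ⟨hH.lt hN hC hp hq0, hH.balance hN hC hp0 hq0⟩
  · rcases hpq.lt_or_eq with hlt | heq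
    · exact ⟨_, ((hsharp h).1 hlt).1⟩
    · exact ⟨_, ((hsharp h).2 heq).1⟩
  · subst hpq'
    exact HomogeneousGroup.QuasiNorm.tendsto_hardyConst hS hp h.1
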